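/- Let units $i=1,2,\dots$ be observed in periods $t=1,\dots,T$. Unit $i$ is first treated in period $t_i^*\in\{2,\dots,T,\infty\}$ ($\infty$ means never), treatment is absorbing, $D_{it}=\mathbf 1(t\ge t_i^*)$, and $\mathcal S$ is the set of cohorts $s$ with $p_s=P[t_i^*=s]>0$. Let $X_i$ be a covariate vector in $\mathbb R^q$, $q\ge1$, and let $Y_{it}(\mathbf d)$ be the potential outcomes, for nondecreasing treatment paths $\mathbf d=(d_1,\dots,d_T)\in\{0,1\}^T$. The observed outcome $Y_{it}$ is the potential outcome under the realized path $(D_{i1},\dots,D_{iT})$, $Y_{it}(0)$ is the one under the path of zeros, and $\tau_{it}=Y_{it}-Y_{it}(0)$ for $t\ge t_i^*$. Assume: 1. (No anticipation) $Y_{it}(\mathbf d)$ depends on $\mathbf d$ only through $(d_1,\dots,d_t)$. 2. (Conditional parallel trends) For all $t\ge2$, $E[Y_{it}(0)-Y_{i,t-1}(0)\mid t_i^*,X_i]=E[Y_{it}(0)-Y_{i,t-1}(0)\mid X_i]$ a.s. 3. (Overlap) $P[t_i^*=\infty]>0$, and for some $\eta>0$, $P[t_i^*=s\mid X_i]<1-\eta$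 a.s. for all $s\in\mathcal S$. 4. (Random sampling) The vectors $(Y_{i1},\dots,Y_{iT},t_i^*,X_i)$ are independent and identically distributed over $i$. 5. (Regularity) (i) For each $s\in\mathcal S$, $X_i$ given $t_i^*=s$ has a Lebesgue density that is continuous on its support, and this support is convex and compact; the density of $X_i$ given $t_i^*=\infty$ is bounded away from zero on the support of $X_i$. For all $s\in\mathcal S$, all $t$ and all paths $\mathbf d$: (ii) $x\mapsto E[Y_{it}(\mathbf d)\mid t_i^*=s,X_i=x]$ is Lipschitz; (iii) $x\mapsto V[Y_{it}(\mathbf d)\mid t_i^*=s,X_i=x]$ is Lipschitz and bounded away from zero; (iv) $E[Y_{it}(\mathbf d)^4\mid t_i^*=s,X_i=x]$ is bounded uniformly in $x$. In (ii)–(iv), $x$ ranges over the support of $X_i$ given $t_i^*=s$. Fix $s\in\mathcal S\setminus\{\infty\}$, $M\ge1$ and nonrandom $\lambda_1,\dots,\lambda_T\in\{0,1\}$ with $\lambda_{t'}=\lambda_t=1$ for some $t'<s\le t$. In the sample of the first $n$ units, let $\mathcal J_M(l,\infty)$ be the set of the $M$ never-treated units $j$ with $X_j$ nearest to $X_l$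 in Euclidean distance; more precisely, the set of never-treated $j$ such that $\sum_{k:\,t_k^*=\infty}\mathbf 1\{\|X_k-X_l\|\le\|X_j-X_l\|\}\in\{1,\dots,M\}$. For a never-treated unit $i$, let $K_M(i,s)=\sum_{l:\,t_l^*=s}\mathbf 1\{i\in\mathcal J_M(l,\infty)\}$, and put $$w_i=w_i^s=\mathbf 1(t_i^*=s)+\mathbf 1(t_i^*=\infty)\frac{K_M(i,s)}{M}.$$ Let $$\hat\tau(w^s,\lambda)=\frac{\sum_i\sum_t w_i\lambda_tY_{it}(D_{it}-\bar D_i-\tilde D_t+\bar D)}{\sum_i\sum_t w_i\lambda_tD_{it}(D_{it}-\bar D_i-\tilde D_t+\bar D)},$$ where $$\bar D_i=\frac{\sum_t\lambda_tD_{it}}{\sum_t\lambda_t},\qquad \tilde D_t=\frac{\sum_iw_iD_{it}}{\sum_iw_i},\qquad \bar D=\frac{\sum_i\sum_tw_i\lambda_tD_{it}}{\sum_iw_i\sum_t\lambda_t}.$$ This is the coefficient on $D_{it}$ in the two-way fixed effects regression $Y_{it}=\alpha_i+\delta_t+\tau D_{it}+u_{it}$ with weights $w_i\lambda_t$. Then,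 as $n\to\infty$, $$\hat\tau(w^s,\lambda)\to_P\frac{\sum_{t\ge s}\lambda_t\,E[\tau_{it}\mid t_i^*=s]}{\sum_{t\ge s}\lambda_t}.$$ -/

import Mathlib

open MeasureTheory ProbabilityTheory Filter Topology

/-- Treatment cohorts of a panel with `T` periods. The periods are the elements of `Fin T`, the
element with value `k` being the calendar period `k + 1`; the cohort `(s : Fin T)` is first treated
in period `s`, and `⊤` (written `∞` in formulas) is never treated. -/
abbrev Cohort (T : ℕ) : Type := WithTop (Fin T)

/-- Treatment paths `(d_1, …, d_T)`: treatment is an absorbing state. -/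
abbrev TreatmentPath (T : ℕ) : Type := {d : Fin T → Bool // Monotone d}

/-- The treatment path of a unit of cohort `c`, that is `d_t = 1(t ≥ c)`; for `c = ⊤` it is the
path of zeros. -/
def cohortPath {T : ℕ} (c : Cohort T) : TreatmentPath T :=
  ⟨fun t => decide (c ≤ (t : Cohort T)), by
    intro a b hab
    by_cases h : c ≤ (a : Cohort T)
    · have h' : c ≤ (b : Cohort T) := h.trans (WithTop.coe_le_coe.mpr hab)
      simp [h, h']
    · simp [h]⟩

/-- Units `i = 0, 1, 2, …` with their potential outcomes `Y_{it}(d)`, cohorts `t_i^*` and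
covariates `X_i ∈ ℝ^q`, as random variables. -/
structure Panel (T q : ℕ) (Ω : Type*) [MeasurableSpace Ω] where
  /-- the potential outcome `Y_{it}(d)` -/
  Y : ℕ → TreatmentPath T → Fin T → Ω → ℝ
  /-- the cohort `t_i^*` -/
  tstar : ℕ → Ω → Cohort T
  /-- the covariates `X_i` -/
  X : ℕ → Ω → EuclideanSpace ℝ (Fin q)
  measurable_Y : ∀ i d t, Measurable (Y i d t)
  measurable_tstar : ∀ i, Measurable (tstar i)
  measurable_X : ∀ i, Measurable (X i)

namespace Panel

variable {T q : ℕ} {Ω : Type*} [MeasurableSpace Ω]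

/-- Untreated potential outcome `Y_{it}(0)`. -/
def Y0 (D : Panel T q Ω) (i : ℕ) (t : Fin T) : Ω → ℝ := D.Y i (cohortPath ⊤) t

/-- Observed outcome `Y_{it}`: the potential outcome under the realized treatment path. -/
def Yobs (D : Panel T q Ω) (i : ℕ) (t : Fin T) : Ω → ℝ :=
  fun ω => D.Y i (cohortPath (D.tstar i ω)) t ω

/-- Unit-level treatment effect `τ_{it} = Y_{it}(t_i^*) - Y_{it}(0)`. -/
def effect (D : Panel T q Ω) (i : ℕ) (t : Fin T) : Ω → ℝ :=
  fun ω => D.Y i (cohortPath (D.tstar i ω)) t ω - D.Y0 i t ω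

/-- The conditional probability measure `P[ · | t_i^* = s]`. -/
noncomputable def condCohort (D : Panel T q Ω) (P : Measure Ω) (i : ℕ) (s : Cohort T) :
    Measure Ω :=
  ProbabilityTheory.cond P (D.tstar i ⁻¹' {s})

/-- The law of `X_i` given `t_i^* = s`. -/
noncomputable def covariateLaw (D : Panel T q Ω) (P : Measure Ω) (i : ℕ) (s : Cohort T) :
    Measure (EuclideanSpace ℝ (Fin q)) :=
  (D.condCohort P i s).map (D.X i)

/-- The cohort-specific average treatment effect on the treated, `E[τ_{it} | t_i^* = s]`. -/
noncomputable def att (D : Panel T q Ω) (P : Measure Ω) (i : ℕ) (s : Cohort T) (t : Fin T) : ℝ :=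
  ∫ ω, D.effect i t ω ∂(D.condCohort P i s)

/-- `σ(X_i)`. -/
@[reducible] def sigmaX (D : Panel T q Ω) (i : ℕ) : MeasurableSpace Ω :=
  MeasurableSpace.comap (D.X i) inferInstance

/-- `σ(t_i^*, X_i)`. -/
@[reducible] def sigmaTX (D : Panel T q Ω) (i : ℕ) : MeasurableSpace Ω :=
  MeasurableSpace.comap (fun ω => (D.tstar i ω, D.X i ω)) inferInstance

/-- `𝒮`: the cohorts of positive probability. -/
def cohorts (D : Panel T q Ω) (P : Measure Ω) (i : ℕ) : Set (Cohort T) :=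
  {s | 0 < P (D.tstar i ⁻¹' {s})}

/-- No unit is treated in the first period. -/
def NoneTreatedFirst (D : Panel T q Ω) (P : Measure Ω) : Prop :=
  ∀ i, ∀ t : Fin T, t.val = 0 → P (D.tstar i ⁻¹' {(t : Cohort T)}) = 0

/-- No treatment anticipation: `Y_{it}(d)` depends on `d` only through `(d_1, …, d_t)`. -/
def NoAnticipation (D : Panel T q Ω) (P : Measure Ω) : Prop :=
  ∀ i, ∀ t : Fin T, ∀ d d' : TreatmentPath T,
    (∀ u ≤ t, d.1 u = d'.1 u) → D.Y i d t =ᵐ[P] D.Y i d' t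

/-- Conditional parallel trends: for all consecutive periods `t' = t - 1` and `t`,
`E[Y_{it}(0) - Y_{it'}(0) | t_i^*, X_i] = E[Y_{it}(0) - Y_{it'}(0) | X_i]` almost surely. -/
def ConditionalParallelTrends (D : Panel T q Ω) (P : Measure Ω) : Prop :=
  ∀ i, ∀ t t' : Fin T, t'.val + 1 = t.val →
    P[D.Y0 i t - D.Y0 i t' | D.sigmaTX i] =ᵐ[P] P[D.Y0 i t - D.Y0 i t' | D.sigmaX i]

/-- Overlap: `P[t_i^* = ∞] > 0`, and for some `η > 0` every propensity score
`e_s(X_i) = P[t_i^* = s | X_i]`, `s ∈ 𝒮`, is below `1 - η` almost surely. -/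
def Overlap (D : Panel T q Ω) (P : Measure Ω) : Prop :=
  ∀ i, 0 < P (D.tstar i ⁻¹' {⊤}) ∧
    ∃ η : ℝ, 0 < η ∧ ∀ s ∈ D.cohorts P i,
      ∀ᵐ ω ∂P, (P[(D.tstar i ⁻¹' {s}).indicator (fun _ => (1 : ℝ)) | D.sigmaX i]) ω < 1 - η

/-- The observation `(Y_{i1}, …, Y_{iT}, t_i^*, X_i)` of unit `i`. -/
def observation (D : Panel T q Ω) (i : ℕ) :
    Ω → (Fin T → ℝ) × Cohort T × EuclideanSpace ℝ (Fin q) :=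
  fun ω => (fun t => D.Yobs i t ω, D.tstar i ω, D.X i ω)

/-- Random sampling: the observations are independent and identically distributed. -/
def RandomSampling (D : Panel T q Ω) (P : Measure Ω) : Prop :=
  iIndepFun D.observation P ∧
    ∀ i j, IdentDistrib (D.observation i) (D.observation j) P P

/-- Regularity of the covariates: given each cohort `s ∈ 𝒮`, `X_i` has a density `f_s` that is
continuous on its support, the support is convex and compact, and the density `f_⊤` of the
never-treated is bounded away from zero on the support of `X_i`. -/
def RegularDensities (D : Panel T q Ω) (P : Measure Ω) : Prop :=
  ∀ i, ∃ f : Cohort T → EuclideanSpace ℝ (Fin q) → ℝ,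
    (∀ s ∈ D.cohorts P i,
      Measurable (f s) ∧ (∀ x, 0 ≤ f s x) ∧
      D.covariateLaw P i s = volume.withDensity (fun x => ENNReal.ofReal (f s x)) ∧
      ContinuousOn (f s) (D.covariateLaw P i s).support ∧
      Convex ℝ (D.covariateLaw P i s).support ∧
      IsCompact (D.covariateLaw P i s).support) ∧
    ∃ c : ℝ, 0 < c ∧ ∀ x ∈ (P.map (D.X i)).support, c ≤ f ⊤ x

/-- `x ↦ E[Y_{it}(d) | t_i^* = s, X_i = x]` exists and is Lipschitz on the support of `X_i` given
`t_i^* = s`. -/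
def LipschitzMean (D : Panel T q Ω) (P : Measure Ω) : Prop :=
  ∀ i, ∀ s ∈ D.cohorts P i, ∀ (t : Fin T) (d : TreatmentPath T),
    Integrable (D.Y i d t) (D.condCohort P i s) ∧
    ∃ (m : EuclideanSpace ℝ (Fin q) → ℝ) (K : NNReal),
      LipschitzOnWith K m (D.covariateLaw P i s).support ∧
      (D.condCohort P i s)[D.Y i d t | D.sigmaX i]
        =ᵐ[D.condCohort P i s] fun ω => m (D.X i ω)

/-- `x ↦ V[Y_{it}(d) | t_i^* = s, X_i = x]` exists and is Lipschitz and bounded away from zero on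
the support of `X_i` given `t_i^* = s`. -/
def LipschitzVariance (D : Panel T q Ω) (P : Measure Ω) : Prop :=
  ∀ i, ∀ s ∈ D.cohorts P i, ∀ (t : Fin T) (d : TreatmentPath T),
    MemLp (D.Y i d t) 2 (D.condCohort P i s) ∧
    ∃ (v : EuclideanSpace ℝ (Fin q) → ℝ) (K : NNReal) (c : ℝ), 0 < c ∧
      LipschitzOnWith K v (D.covariateLaw P i s).support ∧
      (∀ x ∈ (D.covariateLaw P i s).support, c ≤ v x) ∧
      condVar (D.sigmaX i) (D.Y i d t) (D.condCohort P i s)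
        =ᵐ[D.condCohort P i s] fun ω => v (D.X i ω)

/-- `x ↦ E[Y_{it}(d)^4 | t_i^* = s, X_i = x]` exists and is uniformly bounded. -/
def BoundedFourthMoment (D : Panel T q Ω) (P : Measure Ω) : Prop :=
  ∀ i, ∀ s ∈ D.cohorts P i, ∀ (t : Fin T) (d : TreatmentPath T),
    Integrable (fun ω => D.Y i d t ω ^ 4) (D.condCohort P i s) ∧
    ∃ C : ℝ, ∀ᵐ ω ∂(D.condCohort P i s),
      ((D.condCohort P i s)[fun ω' => D.Y i d t ω' ^ 4 | D.sigmaX i]) ω ≤ C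

/-- The regularity conditions. -/
structure Regularity (D : Panel T q Ω) (P : Measure Ω) : Prop where
  densities : D.RegularDensities P
  mean : D.LipschitzMean P
  variance : D.LipschitzVariance P
  fourthMoment : D.BoundedFourthMoment P

end Panel

/-! ### Matching and the weighted two-way fixed effects estimator, for realized data -/

section Estimator

open scoped Classical in
/-- `∑_{l : t_l^* = s'} 1{‖X_l - X_i‖ ≤ ‖X_j - X_i‖}`: the rank of unit `j` by its distance to
unit `i` among the units of cohort `s'`. -/
noncomputable def matchRank {n T q : ℕ} (ts : Fin n → Cohort T)
    (X : Fin n → EuclideanSpace ℝ (Fin q)) (i : Fin n) (s' : Cohort T) (j : Fin n) : ℕ :=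
  (Finset.univ.filter fun l => ts l = s' ∧ ‖X l - X i‖ ≤ ‖X j - X i‖).card

/-- `𝒥_M(i, s') = {j_1(i, s'), …, j_M(i, s')}`: the `M` nearest neighbors of unit `i` in cohort
`s'`, `j_m(i, s')` being the unit of cohort `s'` of rank `m`. -/
noncomputable def nearestNeighbors {n T q : ℕ} (M : ℕ) (ts : Fin n → Cohort T)
    (X : Fin n → EuclideanSpace ℝ (Fin q)) (i : Fin n) (s' : Cohort T) : Set (Fin n) :=
  {j | ts j = s' ∧ ∃ m ∈ Finset.Icc 1 M, matchRank ts X i s' j = m}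

open scoped Classical in
/-- `K_M(i, s) = ∑_{l : t_l^* = s} 1{i ∈ 𝒥_M(l, t_i^*)}`: the number of times unit `i` is used as
a match for units of cohort `s`. -/
noncomputable def matchCount {n T q : ℕ} (M : ℕ) (ts : Fin n → Cohort T)
    (X : Fin n → EuclideanSpace ℝ (Fin q)) (i : Fin n) (s : Cohort T) : ℕ :=
  (Finset.univ.filter fun l => ts l = s ∧ i ∈ nearestNeighbors M ts X l (ts i)).card

/-- The pairwise matching weights `w_i^s = 1(t_i^* = s) + 1(t_i^* = ∞) K_M(i, s) / M`. -/
noncomputable def pairwiseWeight {n T q : ℕ} (M : ℕ) (ts : Fin n → Cohort T)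
    (X : Fin n → EuclideanSpace ℝ (Fin q)) (s : Fin T) (i : Fin n) : ℝ :=
  (if ts i = (s : Cohort T) then 1 else 0) +
    (if ts i = ⊤ then (matchCount M ts X i (s : Cohort T) : ℝ) / M else 0)

/-- The treatment indicator `D_{it} = 1(t ≥ t_i^*)`. -/
def treated {n T : ℕ} (ts : Fin n → Cohort T) (i : Fin n) (t : Fin T) : ℝ :=
  if ts i ≤ (t : Cohort T) then 1 else 0

/-- The demeaned treatment indicator `D_{it} - D̄_i - D̃_t + D̄`, with
`D̄_i = ∑_t λ_t D_{it} / ∑_t λ_t`, `D̃_t = ∑_i w_i D_{it} / ∑_i w_i` and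
`D̄ = ∑_i ∑_t w_i λ_t D_{it} / (∑_i w_i ∑_t λ_t)`. -/
noncomputable def demeanedTreated {n T : ℕ} (w : Fin n → ℝ) (lam : Fin T → ℝ)
    (ts : Fin n → Cohort T) (i : Fin n) (t : Fin T) : ℝ :=
  treated ts i t
    - (∑ u, lam u * treated ts i u) / (∑ u, lam u)
    - (∑ j, w j * treated ts j t) / (∑ j, w j)
    + (∑ j, ∑ u, w j * lam u * treated ts j u) / ((∑ j, w j) * ∑ u, lam u)

/-- The weighted two-way fixed effects estimator `τ̂(w, λ)`: the weighted least squares coefficient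
on `D_{it}` in the regression `Y_{it} = α_i + δ_t + τ D_{it} + u_{it}` with weights `w_i λ_t`. -/
noncomputable def twfe {n T : ℕ} (w : Fin n → ℝ) (lam : Fin T → ℝ)
    (ts : Fin n → Cohort T) (Y : Fin n → Fin T → ℝ) : ℝ :=
  (∑ i, ∑ t, w i * lam t * Y i t * demeanedTreated w lam ts i t) /
    (∑ i, ∑ t, w i * lam t * treated ts i t * demeanedTreated w lam ts i t)

end Estimator

/-- The pairwise matched difference-in-differences estimator `τ̂(w^s, λ)` computed from the first
`n` units. -/
noncomputable def Panel.pairwiseDiD {T q : ℕ} {Ω : Type*} [MeasurableSpace Ω] (D : Panel T q Ω)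
    (M : ℕ) (lam : Fin T → ℝ) (s : Fin T) (n : ℕ) : Ω → ℝ :=
  fun ω =>
    twfe
      (pairwiseWeight M (fun i : Fin n => D.tstar i ω) (fun i : Fin n => D.X i ω) s)
      lam (fun i : Fin n => D.tstar i ω) (fun (i : Fin n) t => D.Yobs i t ω)

/-! Only cohort `s` and the never-treated carry weight, and almost surely for large n every unit of
cohort `s` has exactly M matches, so both groups have the same total weight N_s. The regression
coefficient then collapses (`twfe_eq`) to a matched difference in means of the scalar contrast Z_i =
∑_t a_t Y_it, where a_t = λ_t / ∑_{u ≥ s} λ_u for t ≥ s and a_t = -λ_t / ∑_{u < s} λ_u for t < s.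

Let m be the regression function of Z on X among the never-treated. Writing Z = m(X) + residual for
the controls splits the matched difference into three terms. The mean of Z - m(X) over cohort `s`
obeys the law of large numbers. The matching discrepancy in m vanishes because m is Lipschitz and
the controls fill out a compact set containing almost all covariates. The third term is the sum of
the control residuals weighted by the match counts K_j. Given cohorts and covariates, these
residuals are centred and uncorrelated with bounded variance, so after division by n its second
moment is at most a constant times E[∑_j K_j²] / n² (`integral_controlCount_sq_le`). A control is
matched only to units in a small ball around it and the covariate law has no atoms, so max_j K_j =
o(n) (`ae_eventually_controlCount_le`). Since ∑_j K_j ≤ M n, it follows that ∑_j K_j² = o(n²).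

Identification: since ∑_t a_t = 0, parallel trends make E[∑_t a_t Y_t(0) | t*, X] a function of X
alone. It equals m(X) in the whole population because the law of X is absolutely continuous with
respect to its law among the never-treated (`condExp_untreatedContrast_ae_eq`). The limit is thus
∑_t a_t E[τ_t | t* = s], and no anticipation removes the terms with t < s. -/

/-! ### Combinatorics of nearest neighbor matching -/

section Matching

open scoped Classical

variable {n T q M : ℕ} {ts : Fin n → Cohort T} {X : Fin n → EuclideanSpace ℝ (Fin q)}
  {s' : Cohort T} {i : Fin n}

/-- The nearest neighbors as a finite set. -/
noncomputable def neighborFinset (M : ℕ) (ts : Fin n → Cohort T)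
    (X : Fin n → EuclideanSpace ℝ (Fin q)) (i : Fin n) (s' : Cohort T) : Finset (Fin n) :=
  Finset.univ.filter fun j => j ∈ nearestNeighbors M ts X i s'

theorem mem_neighborFinset {j : Fin n} :
    j ∈ neighborFinset M ts X i s' ↔
      ts j = s' ∧ 1 ≤ matchRank ts X i s' j ∧ matchRank ts X i s' j ≤ M := by
  simp [neighborFinset, nearestNeighbors]

theorem one_le_matchRank {j : Fin n} (hj : ts j = s') : 1 ≤ matchRank ts X i s' j := by
  rw [matchRank, Nat.one_le_iff_ne_zero, Finset.card_ne_zero]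
  exact ⟨j, by simp [hj]⟩

/-- The rank of the farthest neighbor counts all neighbors, and it is at most M. Ties can only make
the set smaller. -/
theorem card_neighborFinset_le : (neighborFinset M ts X i s').card ≤ M := by
  rcases (neighborFinset M ts X i s').eq_empty_or_nonempty with h | h
  · simp [h]
  · obtain ⟨j, hj, hmax⟩ := Finset.exists_max_image _ (fun j => ‖X j - X i‖) h
    refine le_trans (Finset.card_le_card fun k hk => ?_) (mem_neighborFinset.1 hj).2.2
    simp only [Finset.mem_filter, Finset.mem_univ, true_and]
    exact ⟨(mem_neighborFinset.1 hk).1, hmax k hk⟩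

/-- Without ties the rank is injective on the cohort, hence a bijection onto {1, …, size of the
cohort}; the neighbors are the preimage of {1, …, M}. -/
theorem card_neighborFinset_eq
    (hinj : ∀ j k, ts j = s' → ts k = s' → ‖X j - X i‖ = ‖X k - X i‖ → j = k)
    (hM : M ≤ (Finset.univ.filter fun j => ts j = s').card) :
    (neighborFinset M ts X i s').card = M := by
  set B := Finset.univ.filter fun j => ts j = s' with hB
  have hlt : ∀ j k, ts j = s' → ts k = s' → ‖X j - X i‖ < ‖X k - X i‖ →
      matchRank ts X i s' j < matchRank ts X i s' k := by
    intro j k _ hk hjk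
    refine Finset.card_lt_card ⟨fun l hl => ?_, fun hsub => ?_⟩
    · simp only [Finset.mem_filter, Finset.mem_univ, true_and] at hl ⊢
      exact ⟨hl.1, hl.2.trans hjk.le⟩
    · have : k ∈ Finset.univ.filter fun l => ts l = s' ∧ ‖X l - X i‖ ≤ ‖X j - X i‖ :=
        hsub (by simp [hk])
      simp only [Finset.mem_filter, Finset.mem_univ, true_and] at this
      exact absurd this.2 (not_le.2 hjk)
  have hrank : Set.InjOn (matchRank ts X i s') B := by
    intro j hj k hk hjk
    replace hj : ts j = s' := (Finset.mem_filter.1 hj).2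
    replace hk : ts k = s' := (Finset.mem_filter.1 hk).2
    by_contra hne
    rcases lt_or_gt_of_ne (fun h => hne (hinj j k hj hk h)) with h | h
    · exact absurd hjk (hlt j k hj hk h).ne
    · exact absurd hjk (hlt k j hk hj h).ne'
  have himage : B.image (matchRank ts X i s') = Finset.Icc 1 B.card := by
    refine Finset.eq_of_subset_of_card_le (fun m hm => ?_) ?_
    · obtain ⟨j, hj, rfl⟩ := Finset.mem_image.1 hm
      refine Finset.mem_Icc.2 ⟨one_le_matchRank (Finset.mem_filter.1 hj).2, ?_⟩
      refine Finset.card_le_card fun l hl => ?_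
      simp only [Finset.mem_filter, Finset.mem_univ, true_and, hB] at hl ⊢
      exact hl.1
    · rw [Finset.card_image_of_injOn hrank]
      simp
  have hsub : neighborFinset M ts X i s' ⊆ B := fun j hj => by
    simpa [hB] using (mem_neighborFinset.1 hj).1
  have hJ : (neighborFinset M ts X i s').image (matchRank ts X i s') = Finset.Icc 1 M := by
    ext m
    simp only [Finset.mem_image, Finset.mem_Icc]
    constructor
    · rintro ⟨j, hj, rfl⟩
      exact (mem_neighborFinset.1 hj).2
    · rintro ⟨h1, h2⟩
      have : m ∈ B.image (matchRank ts X i s') := by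
        rw [himage]
        exact Finset.mem_Icc.2 ⟨h1, h2.trans hM⟩
      obtain ⟨j, hj, rfl⟩ := Finset.mem_image.1 this
      exact ⟨j, mem_neighborFinset.2 ⟨(Finset.mem_filter.1 hj).2, h1, h2⟩, rfl⟩
  rw [← Finset.card_image_of_injOn (hrank.mono hsub), hJ]
  simp

/-- The rank of a unit farther away than ε counts at least M closer units and the unit itself, so it
exceeds M. -/
theorem norm_sub_le_of_mem_neighborFinset {ε : ℝ}
    (hM : M ≤ (Finset.univ.filter fun j => ts j = s' ∧ ‖X j - X i‖ ≤ ε).card)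
    {j : Fin n} (hj : j ∈ neighborFinset M ts X i s') : ‖X j - X i‖ ≤ ε := by
  by_contra! h
  have hj' := mem_neighborFinset.1 hj
  have : (Finset.univ.filter fun j => ts j = s' ∧ ‖X j - X i‖ ≤ ε).card
      < matchRank ts X i s' j := by
    refine Finset.card_lt_card ⟨fun l hl => ?_, fun hsub => ?_⟩
    · simp only [Finset.mem_filter, Finset.mem_univ, true_and] at hl ⊢
      exact ⟨hl.1, hl.2.trans h.le⟩
    · have : j ∈ Finset.univ.filter fun l => ts l = s' ∧ ‖X l - X i‖ ≤ ε :=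
        hsub (by simp [hj'.1])
      simp only [Finset.mem_filter, Finset.mem_univ, true_and] at this
      exact absurd this.2 (not_le.2 h)
  omega

theorem matchCount_eq {j : Fin n} (hj : ts j = s') (s : Cohort T) :
    matchCount M ts X j s =
      ((Finset.univ.filter fun l => ts l = s).filter
        fun l => j ∈ neighborFinset M ts X l s').card := by
  rw [matchCount, Finset.filter_filter, hj]
  congr 1
  ext l
  simp [neighborFinset]

/-- Double counting of pairs (unit of cohort `s`, match): it turns sums weighted by match counts
into sums over the matches of each treated unit. -/
theorem sum_matchCount_mul (s : Cohort T) (f : Fin n → ℝ) :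
    ∑ j with ts j = s', (matchCount M ts X j s : ℝ) * f j =
      ∑ l with ts l = s, ∑ j ∈ neighborFinset M ts X l s', f j := by
  have h1 : ∀ l, neighborFinset M ts X l s' =
      (Finset.univ.filter fun j => ts j = s').filter
        fun j => j ∈ neighborFinset M ts X l s' := by
    intro l
    ext j
    simp only [Finset.mem_filter, Finset.mem_univ, true_and]
    exact ⟨fun h => ⟨(mem_neighborFinset.1 h).1, h⟩, fun h => h.2⟩
  calc ∑ j with ts j = s', (matchCount M ts X j s : ℝ) * f j
      = ∑ j with ts j = s', ∑ l with ts l = s,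
          if j ∈ neighborFinset M ts X l s' then f j else 0 := by
        refine Finset.sum_congr rfl fun j hj => ?_
        rw [matchCount_eq (Finset.mem_filter.1 hj).2, ← Finset.sum_filter]
        simp
    _ = ∑ l with ts l = s, ∑ j with ts j = s',
          if j ∈ neighborFinset M ts X l s' then f j else 0 := Finset.sum_comm
    _ = _ := by
        refine Finset.sum_congr rfl fun l _ => ?_
        rw [← Finset.sum_filter, ← h1 l]

theorem sum_matchCount_le (s : Cohort T) :
    ∑ j with ts j = s', (matchCount M ts X j s : ℝ) ≤ M * n := by
  have h := sum_matchCount_mul (M := M) (ts := ts) (X := X) (s' := s') s (fun _ => 1)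
  simp only [mul_one, Finset.sum_const, nsmul_eq_mul] at h
  rw [h]
  calc ∑ l with ts l = s, ((neighborFinset M ts X l s').card : ℝ)
      ≤ ∑ l with ts l = s, (M : ℝ) :=
        Finset.sum_le_sum fun l _ => by exact_mod_cast card_neighborFinset_le
    _ ≤ ∑ l : Fin n, (M : ℝ) :=
        Finset.sum_le_sum_of_subset_of_nonneg (Finset.filter_subset _ _)
          fun _ _ _ => Nat.cast_nonneg _
    _ = M * n := by simp [mul_comm]

theorem matchCount_le (s : Cohort T) (j : Fin n) : matchCount M ts X j s ≤ n :=
  (Finset.card_le_univ _).trans (by simp)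

end Matching

/-! ### The weighted two-way fixed effects estimator as a difference in differences -/

/-- The period weights of the difference in differences behind the two-way fixed effects
estimator. -/
noncomputable def periodWeight {T : ℕ} (lam : Fin T → ℝ) (s t : Fin T) : ℝ :=
  lam t * ((if s ≤ t then 1 else 0) - (∑ u with s ≤ u, lam u) / ∑ u, lam u) *
    ((∑ u, lam u) / ((∑ u with s ≤ u, lam u) * ∑ u with ¬ s ≤ u, lam u))

section PeriodWeight

variable {T : ℕ} {lam : Fin T → ℝ} {s : Fin T}

/-- The post-period indicator is centred at its λ-mean. The zero sum makes the contrast insensitive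
to unit effects, which is what parallel trends require. -/
theorem sum_periodWeight (hpost : ∑ u, lam u ≠ 0) : ∑ t, periodWeight lam s t = 0 := by
  unfold periodWeight
  rw [← Finset.sum_mul]
  have : ∑ t, lam t * ((if s ≤ t then 1 else 0) - (∑ u with s ≤ u, lam u) / ∑ u, lam u) = 0 := by
    simp only [mul_sub, Finset.sum_sub_distrib, mul_ite, mul_one, mul_zero, ← Finset.sum_mul,
      ← Finset.sum_filter]
    field_simp
    ring
  rw [this, zero_mul]

/-- The last factor of `periodWeight` is the normalization under which the post-period weights sum
to one. -/
theorem periodWeight_of_le (h1 : ∑ u with s ≤ u, lam u ≠ 0) (h0 : ∑ u with ¬ s ≤ u, lam u ≠ 0)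
    (h : ∑ u, lam u ≠ 0) {t : Fin T} (ht : s ≤ t) :
    periodWeight lam s t = lam t / ∑ u with s ≤ u, lam u := by
  have hsum := Finset.sum_filter_add_sum_filter_not Finset.univ (fun u => s ≤ u) lam
  unfold periodWeight
  rw [if_pos ht]
  have e : (1 : ℝ) - (∑ u with s ≤ u, lam u) / ∑ u, lam u
      = (∑ u with ¬ s ≤ u, lam u) / ∑ u, lam u := by
    rw [eq_div_iff h, sub_mul, div_mul_cancel₀ _ h]
    linarith
  rw [e]
  field_simp

end PeriodWeight

open scoped Classical in
-- Both groups have total weight N, so at each t ≥ s the weighted treated share is one half. The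
-- demeaned treatment is therefore the λ-centred post indicator times 1/2 on cohort `s` and times
-- -1/2 on the never-treated. Multiplied by λ_t this is ± c times `periodWeight`, and c cancels
-- between numerator and denominator.
theorem twfe_eq {n T : ℕ} {w : Fin n → ℝ} {lam : Fin T → ℝ} {ts : Fin n → Cohort T}
    {s : Fin T} (Y : Fin n → Fin T → ℝ)
    (h1 : ∑ u with s ≤ u, lam u ≠ 0) (h0 : ∑ u with ¬ s ≤ u, lam u ≠ 0) (h : ∑ u, lam u ≠ 0)
    (hA : ∀ i, ts i = s → w i = 1) (hw : ∀ i, ts i ≠ s → ts i ≠ ⊤ → w i = 0)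
    (hN : ∑ i with ts i = ⊤, w i = (Finset.univ.filter fun i => ts i = (s : Cohort T)).card)
    (hpos : (Finset.univ.filter fun i => ts i = (s : Cohort T)).card ≠ 0) :
    twfe w lam ts Y =
      (∑ i with ts i = (s : Cohort T), ∑ t, periodWeight lam s t * Y i t
        - ∑ i with ts i = ⊤, w i * ∑ t, periodWeight lam s t * Y i t) /
        (Finset.univ.filter fun i => ts i = (s : Cohort T)).card := by
  set N : ℝ := ((Finset.univ.filter fun i => ts i = (s : Cohort T)).card : ℝ) with hNdef
  have hN0 : N ≠ 0 := Nat.cast_ne_zero.2 hpos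
  set L := ∑ u, lam u with hL
  set L1 := ∑ u with s ≤ u, lam u with hL1
  set L0 := ∑ u with ¬ s ≤ u, lam u with hL0
  have hsum : L1 + L0 = L := Finset.sum_filter_add_sum_filter_not Finset.univ (fun u => s ≤ u) lam
  have split : ∀ f : Fin n → ℝ, ∑ i, w i * f i =
      ∑ i with ts i = (s : Cohort T), f i + ∑ i with ts i = ⊤, w i * f i := by
    intro f
    rw [Finset.sum_filter, Finset.sum_filter, ← Finset.sum_add_distrib]
    refine Finset.sum_congr rfl fun i _ => ?_
    by_cases his : ts i = (s : Cohort T)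
    · simp [his, hA i his]
    · by_cases hit : ts i = ⊤
      · simp [hit]
      · simp [his, hit, hw i his hit]
  have trA : ∀ i t, ts i = (s : Cohort T) → treated ts i t = if s ≤ t then 1 else 0 := by
    intro i t hi
    simp only [treated, hi, WithTop.coe_le_coe]
  have trB : ∀ i t, ts i = ⊤ → treated ts i t = 0 := by
    intro i t hi
    simp [treated, hi]
  have sw : ∑ j, w j = 2 * N := by
    have := split fun _ => 1
    simp only [mul_one, Finset.sum_const, nsmul_eq_mul] at this
    rw [this, hN]; ring
  have stw : ∀ t, ∑ j, w j * treated ts j t = N * if s ≤ t then 1 else 0 := by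
    intro t
    rw [split, Finset.sum_congr rfl fun i hi => trA i t (Finset.mem_filter.1 hi).2,
      Finset.sum_congr (s₁ := Finset.univ.filter fun i => ts i = ⊤) rfl
        fun i hi => by rw [trB i t (Finset.mem_filter.1 hi).2]]
    simp [hNdef]
  have sw2 : ∑ j, ∑ u, w j * lam u * treated ts j u = N * L1 := by
    rw [Finset.sum_comm]
    have : ∀ u, ∑ j, w j * lam u * treated ts j u = N * (if s ≤ u then lam u else 0) := by
      intro u
      have := stw u
      calc ∑ j, w j * lam u * treated ts j u = lam u * ∑ j, w j * treated ts j u := by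
            rw [Finset.mul_sum]; exact Finset.sum_congr rfl fun j _ => by ring
        _ = _ := by rw [this]; split_ifs <;> ring
    rw [Finset.sum_congr rfl fun u _ => this u, ← Finset.mul_sum, ← Finset.sum_filter]
  have dA : ∀ i t, ts i = (s : Cohort T) →
      demeanedTreated w lam ts i t = ((if s ≤ t then 1 else 0) - L1 / L) / 2 := by
    intro i t hi
    have e : ∑ u, lam u * treated ts i u = L1 := by
      rw [hL1, Finset.sum_filter]
      exact Finset.sum_congr rfl fun u _ => by rw [trA i u hi]; split_ifs <;> simp
    rw [demeanedTreated, e, trA i t hi, stw, sw, sw2, ← hL]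
    field_simp
    ring
  have dB : ∀ i t, ts i = ⊤ →
      demeanedTreated w lam ts i t = -(((if s ≤ t then 1 else 0) - L1 / L) / 2) := by
    intro i t hi
    have e : ∑ u, lam u * treated ts i u = 0 :=
      Finset.sum_eq_zero fun u _ => by rw [trB i u hi, mul_zero]
    rw [demeanedTreated, e, trB i t hi, stw, sw, sw2, ← hL]
    field_simp
    ring
  set c : ℝ := L1 * L0 / L / 2 with hc
  have hc0 : c ≠ 0 := by
    rw [hc]
    positivity
  have hpw : ∀ t, lam t * (((if s ≤ t then 1 else 0) - L1 / L) / 2) = c * periodWeight lam s t := by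
    intro t
    rw [periodWeight, hc, ← hL, ← hL1, ← hL0]
    field_simp
  have general : ∀ Z : Fin n → Fin T → ℝ,
      ∑ i, ∑ t, w i * lam t * Z i t * demeanedTreated w lam ts i t =
        c * (∑ i with ts i = (s : Cohort T), ∑ t, periodWeight lam s t * Z i t
        - ∑ i with ts i = ⊤, w i * ∑ t, periodWeight lam s t * Z i t) := by
    intro Z
    have : ∀ i, ∑ t, w i * lam t * Z i t * demeanedTreated w lam ts i t =
        w i * ∑ t, lam t * demeanedTreated w lam ts i t * Z i t := by
      intro i
      rw [Finset.mul_sum]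
      exact Finset.sum_congr rfl fun t _ => by ring
    rw [Finset.sum_congr rfl fun i _ => this i, split, mul_sub, sub_eq_add_neg, Finset.mul_sum,
      Finset.mul_sum, ← Finset.sum_neg_distrib]
    congr 1
    · refine Finset.sum_congr rfl fun i hi => ?_
      rw [Finset.mul_sum]
      refine Finset.sum_congr rfl fun t _ => ?_
      rw [dA i t (Finset.mem_filter.1 hi).2, hpw]
      ring
    · refine Finset.sum_congr rfl fun i hi => ?_
      rw [Finset.mul_sum, Finset.mul_sum, Finset.mul_sum, ← Finset.sum_neg_distrib]
      refine Finset.sum_congr rfl fun t _ => ?_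
      rw [dB i t (Finset.mem_filter.1 hi).2, mul_neg, hpw]
      ring
  -- The denominator is the numerator with the outcome replaced by the treatment: a unit of cohort
  -- `s` contributes the sum of the post-period weights, which is 1, and a control contributes 0.
  have hden : ∑ i with ts i = (s : Cohort T), ∑ t, periodWeight lam s t * treated ts i t
        - ∑ i with ts i = ⊤, w i * ∑ t, periodWeight lam s t * treated ts i t = N := by
    have e1 : ∀ i, ts i = (s : Cohort T) → ∑ t, periodWeight lam s t * treated ts i t = 1 := by
      intro i hi
      have : ∀ t, periodWeight lam s t * treated ts i t = if s ≤ t then lam t / L1 else 0 := by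
        intro t
        rw [trA i t hi]
        split_ifs with hst
        · rw [mul_one, periodWeight_of_le h1 h0 h hst]
        · simp
      rw [Finset.sum_congr rfl fun t _ => this t, ← Finset.sum_filter, ← Finset.sum_div,
        div_self h1]
    have e2 : ∀ i, ts i = ⊤ → w i * ∑ t, periodWeight lam s t * treated ts i t = 0 := by
      intro i hi
      rw [Finset.sum_eq_zero fun t _ => by rw [trB i t hi, mul_zero], mul_zero]
    rw [Finset.sum_congr rfl fun i hi => e1 i (Finset.mem_filter.1 hi).2,
      Finset.sum_eq_zero fun i hi => e2 i (Finset.mem_filter.1 hi).2]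
    simp [hNdef]
  rw [twfe, general Y, general (treated ts), hden, mul_div_mul_left _ _ hc0]

/-! ### Resampling one coordinate of an independent family -/

section Resample

variable {Ω ι β : Type*} [MeasurableSpace Ω] {P : Measure Ω}
  [Fintype ι] [DecidableEq ι] [MeasurableSpace β] {V : ι → Ω → β}

/-- Once coordinate `j` is overwritten by a constant, the vector is a function of the other
coordinates only. -/
theorem indepFun_update (hV : ∀ i, Measurable (V i)) (hind : iIndepFun V P) (j : ι) (b : β) :
    IndepFun (fun ω => Function.update (fun i => V i ω) j b) (V j) P := by
  have h := hind.indepFun_finset (Finset.univ.erase j) {j} (by simp) hV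
  let f : ((i : (Finset.univ.erase j : Finset ι)) → β) → ι → β := fun v i =>
    if hi : i = j then b else v ⟨i, by simp [hi]⟩
  let g : ((i : ({j} : Finset ι)) → β) → β := fun v => v ⟨j, by simp⟩
  have hf : Measurable f := by
    refine measurable_pi_lambda _ fun i => ?_
    by_cases hi : i = j
    · simp only [f, hi, dite_true]
      exact measurable_const
    · simp only [f, hi, dite_false]
      exact measurable_pi_apply _
  have hg : Measurable g := measurable_pi_apply _
  convert h.comp hf hg using 1
  · funext ω i
    by_cases hi : i = j
    · subst hi
      simp [f]
    · simp [f, hi]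
  · rfl

/-- The joint law of the other coordinates and of `V j` is a product, so Fubini permits a fresh draw
of coordinate `j` with the others held fixed. This replaces conditioning on all other units. -/
theorem integral_resample [IsProbabilityMeasure P] (hV : ∀ i, Measurable (V i))
    (hind : iIndepFun V P) (j : ι)
    {F : (ι → β) → ℝ} (hF : Measurable F) (hint : Integrable (fun ω => F fun i => V i ω) P) :
    ∫ ω, F (fun i => V i ω) ∂P =
      ∫ ω, ∫ a, F (Function.update (fun i => V i ω) j a) ∂(P.map (V j)) ∂P := by
  obtain ⟨ω₀⟩ : Nonempty Ω := P.nonempty_of_neZero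
  -- An arbitrary filler for coordinate `j`, overwritten again in `G`.
  set b := V j ω₀
  set W : Ω → ι → β := fun ω => Function.update (fun i => V i ω) j b
  have hW : Measurable W := by
    refine measurable_pi_lambda _ fun i => ?_
    by_cases hi : i = j
    · subst hi
      simp only [W, Function.update_self]
      exact measurable_const
    · simp only [W, Function.update_of_ne hi]
      exact hV i
  have hmap := (indepFun_iff_map_prod_eq_prod_map_map hW.aemeasurable
    (hV j).aemeasurable).1 (indepFun_update hV hind j b)
  have : IsProbabilityMeasure (P.map (V j)) := Measure.isProbabilityMeasure_map (hV j).aemeasurable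
  have : IsProbabilityMeasure (P.map W) := Measure.isProbabilityMeasure_map hW.aemeasurable
  set G : (ι → β) × β → ℝ := fun p => F (Function.update p.1 j p.2)
  have hG : Measurable G := by
    refine hF.comp (measurable_pi_lambda _ fun i => ?_)
    by_cases hi : i = j
    · subst hi
      simp only [Function.update_self]
      exact measurable_snd
    · simp only [Function.update_of_ne hi]
      exact (measurable_pi_apply i).comp measurable_fst
  have hpair : Measurable fun ω => (W ω, V j ω) := hW.prodMk (hV j)
  have hGW : (fun ω => G (W ω, V j ω)) = fun ω => F fun i => V i ω := by
    funext ω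
    simp [G, W]
  have hGint : Integrable G ((P.map W).prod (P.map (V j))) := by
    rw [← hmap, integrable_map_measure hG.aestronglyMeasurable hpair.aemeasurable]
    simpa only [Function.comp_def, hGW] using hint
  calc ∫ ω, F (fun i => V i ω) ∂P = ∫ ω, G (W ω, V j ω) ∂P := by rw [hGW]
    _ = ∫ p, G p ∂(P.map fun ω => (W ω, V j ω)) :=
        (integral_map hpair.aemeasurable hG.aestronglyMeasurable).symm
    _ = ∫ v, ∫ a, G (v, a) ∂(P.map (V j)) ∂(P.map W) := by rw [hmap, integral_prod _ hGint]
    _ = ∫ ω, ∫ a, G (W ω, a) ∂(P.map (V j)) ∂P :=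
        integral_map hW.aemeasurable hGint.integral_prod_left.aestronglyMeasurable
    _ = _ := by simp [G, W]

end Resample

/-! ### The model of a matched sample -/

/-- The residual of an untreated observation `(u, c, x)` with respect to the regression function
`m`. -/
noncomputable def controlResidual {T q : ℕ} (m : EuclideanSpace ℝ (Fin q) → ℝ)
    (a : ℝ × Cohort T × EuclideanSpace ℝ (Fin q)) : ℝ :=
  if a.2.1 = ⊤ then a.1 - m a.2.2 else 0

/-- The conditions on the law `μ` of an observation (outcome, cohort, covariates) under which
matching cohort `s` with the never-treated is consistent; `m` is the regression function of the
never-treated. -/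
structure MatchingModel {T q : ℕ} (μ : Measure (ℝ × Cohort T × EuclideanSpace ℝ (Fin q)))
    (s : Cohort T) (m : EuclideanSpace ℝ (Fin q) → ℝ) : Prop where
  integrable_residual : Integrable (fun a => a.1 - m a.2.2) μ
  treated_ne_zero : μ {a | a.2.1 = s} ≠ 0
  lipschitz : ∃ K, LipschitzWith K m
  support : ∃ S, IsCompact S ∧ (∀ᵐ a ∂μ, a.2.2 ∈ S) ∧
    ∀ x ∈ S, ∀ ε > 0, μ {a | a.2.1 = ⊤ ∧ a.2.2 ∈ Metric.ball x ε} ≠ 0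
  sphere_null : ∀ x r, μ {a | dist a.2.2 x = r} = 0
  integrable_sq : Integrable (fun a => controlResidual m a ^ 2) μ
  mean_zero : ∀ φ : Cohort T × EuclideanSpace ℝ (Fin q) → ℝ, Measurable φ →
    (∃ B, ∀ z, |φ z| ≤ B) → ∫ a, φ a.2 * controlResidual m a ∂μ = 0
  variance_le : ∃ C, 0 ≤ C ∧ ∀ φ : Cohort T × EuclideanSpace ℝ (Fin q) → ℝ, Measurable φ →
    (∀ z, 0 ≤ φ z) → (∃ B, ∀ z, |φ z| ≤ B) →
    ∫ a, φ a.2 * controlResidual m a ^ 2 ∂μ ≤ C * ∫ a, φ a.2 ∂μ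

theorem measurable_controlResidual {T q : ℕ} {m : EuclideanSpace ℝ (Fin q) → ℝ}
    (hm : Measurable m) : Measurable (controlResidual (T := T) m) := by
  unfold controlResidual
  refine Measurable.ite ?_ (by fun_prop) measurable_const
  exact (measurable_fst.comp measurable_snd) (measurableSet_singleton _)

/-- The number of times unit `j` is used as a control, as a function of all cohorts and
covariates. -/
noncomputable def controlCount {n T q : ℕ} (M : ℕ) (s : Cohort T)
    (z : Fin n → Cohort T × EuclideanSpace ℝ (Fin q)) (j : Fin n) : ℝ :=
  if (z j).1 = ⊤ then (matchCount M (fun i => (z i).1) (fun i => (z i).2) j s : ℝ) else 0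

section ControlCount

variable {n T q M : ℕ} {s : Cohort T}

theorem measurable_matchRank (i : Fin n) (s' : Cohort T) (j : Fin n) :
    Measurable fun z : Fin n → Cohort T × EuclideanSpace ℝ (Fin q) =>
      matchRank (fun i => (z i).1) (fun i => (z i).2) i s' j := by
  unfold matchRank
  simp only [Finset.card_filter]
  refine Finset.measurable_sum _ fun l _ => Measurable.ite ?_ measurable_const measurable_const
  exact MeasurableSet.inter (s₁ := {z : Fin n → Cohort T × EuclideanSpace ℝ (Fin q) | (z l).1 = s'})
    ((measurable_fst.comp (measurable_pi_apply l)) (measurableSet_singleton _))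
    (measurableSet_le (f := fun z : Fin n → Cohort T × EuclideanSpace ℝ (Fin q) =>
      ‖(z l).2 - (z i).2‖) (g := fun z => ‖(z j).2 - (z i).2‖) (by fun_prop) (by fun_prop))

theorem measurable_controlCount (j : Fin n) :
    Measurable fun z : Fin n → Cohort T × EuclideanSpace ℝ (Fin q) => controlCount M s z j := by
  classical
  have hc : ∀ (l : Fin n) (c : Cohort T),
      MeasurableSet {z : Fin n → Cohort T × EuclideanSpace ℝ (Fin q) | (z l).1 = c} := fun l c =>
    (measurable_fst.comp (measurable_pi_apply l)) (measurableSet_singleton c)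
  have : (fun z : Fin n → Cohort T × EuclideanSpace ℝ (Fin q) => controlCount M s z j) =
      fun z => if (z j).1 = ⊤ then
        ∑ l, if (z l).1 = s ∧ matchRank (fun i => (z i).1) (fun i => (z i).2) l ⊤ j ∈
          Finset.Icc 1 M then (1 : ℝ) else 0 else 0 := by
    funext z
    rw [controlCount]
    split_ifs with h
    · rw [matchCount_eq h, Finset.filter_filter, Finset.card_filter, Nat.cast_sum]
      refine Finset.sum_congr rfl fun l _ => ?_
      simp only [mem_neighborFinset, Finset.mem_Icc, h, true_and]
      push_cast
      rfl
    · rfl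
  rw [this]
  refine Measurable.ite (hc j ⊤) (Finset.measurable_sum _ fun l _ =>
    Measurable.ite (MeasurableSet.inter (hc l s)
      (measurable_matchRank l ⊤ j (Finset.measurableSet (Finset.Icc 1 M))))
      measurable_const measurable_const) measurable_const

theorem controlCount_nonneg (z : Fin n → Cohort T × EuclideanSpace ℝ (Fin q)) (j : Fin n) :
    0 ≤ controlCount M s z j := by
  rw [controlCount]
  split_ifs <;> positivity

theorem controlCount_le (z : Fin n → Cohort T × EuclideanSpace ℝ (Fin q)) (j : Fin n) :
    controlCount M s z j ≤ n := by
  rw [controlCount]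
  split_ifs
  · exact_mod_cast matchCount_le s j
  · positivity

theorem abs_controlCount_le (z : Fin n → Cohort T × EuclideanSpace ℝ (Fin q)) (j : Fin n) :
    |controlCount M s z j| ≤ n := by
  rw [abs_of_nonneg (controlCount_nonneg z j)]
  exact controlCount_le z j

theorem sum_controlCount_le (z : Fin n → Cohort T × EuclideanSpace ℝ (Fin q)) :
    ∑ j, controlCount M s z j ≤ M * n := by
  classical
  simp only [controlCount, ← Finset.sum_filter]
  convert sum_matchCount_le s

end ControlCount

/-! ### The second moment of the matching noise -/

section Noise

variable {Ω : Type*} [MeasurableSpace Ω] {P : Measure Ω} [IsProbabilityMeasure P] {n T q M : ℕ}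
  {s : Cohort T} {m : EuclideanSpace ℝ (Fin q) → ℝ}
  {μ : Measure (ℝ × Cohort T × EuclideanSpace ℝ (Fin q))}
  {V : Fin n → Ω → ℝ × Cohort T × EuclideanSpace ℝ (Fin q)}

/-- The counts depend on cohorts and covariates only, not on outcomes. In the expanded square, a
fresh draw of unit `j` annihilates the cross terms by `mean_zero` and bounds the diagonal terms
through the conditional second moment. -/
theorem integral_controlCount_sq_le (hμ : MatchingModel μ s m) {C : ℝ}
    (hC : ∀ φ : Cohort T × EuclideanSpace ℝ (Fin q) → ℝ, Measurable φ →
      (∀ z, 0 ≤ φ z) → (∃ B, ∀ z, |φ z| ≤ B) →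
      ∫ a, φ a.2 * controlResidual m a ^ 2 ∂μ ≤ C * ∫ a, φ a.2 ∂μ)
    (hV : ∀ i, Measurable (V i)) (hind : iIndepFun V P) (hlaw : ∀ i, P.map (V i) = μ) :
    ∫ ω, (∑ j, controlCount M s (fun i => (V i ω).2) j * controlResidual m (V j ω)) ^ 2 ∂P ≤
      C * ∫ ω, ∑ j, controlCount M s (fun i => (V i ω).2) j ^ 2 ∂P := by
  obtain ⟨K, hK⟩ := hμ.lipschitz
  have hm : Measurable m := hK.continuous.measurable
  have he : Measurable (controlResidual (T := T) m) := measurable_controlResidual hm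
  have hcm : ∀ j, Measurable fun v : Fin n → ℝ × Cohort T × EuclideanSpace ℝ (Fin q) =>
      controlCount M s (fun i => (v i).2) j := fun j =>
    (measurable_controlCount j).comp
      (measurable_pi_lambda _ fun i => measurable_snd.comp (measurable_pi_apply i))
  have hVm : Measurable fun ω i => V i ω := measurable_pi_lambda _ hV
  have hcV : ∀ j, Measurable fun ω => controlCount M s (fun i => (V i ω).2) j := fun j =>
    (hcm j).comp hVm
  have hL2 : ∀ j, MemLp (fun ω => controlResidual m (V j ω)) 2 P := by
    intro j
    refine (memLp_two_iff_integrable_sq (he.comp (hV j)).aestronglyMeasurable).2 ?_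
    have := hμ.integrable_sq
    rw [← hlaw j, integrable_map_measure (he.pow_const 2).aestronglyMeasurable
      (hV j).aemeasurable] at this
    exact this
  have hprod : ∀ j k, Integrable (fun ω =>
      (controlCount M s (fun i => (V i ω).2) j * controlCount M s (fun i => (V i ω).2) k) *
      (controlResidual m (V j ω) * controlResidual m (V k ω))) P := by
    intro j k
    refine ((hL2 j).integrable_mul (hL2 k)).bdd_mul (c := (n : ℝ) * n)
      ((hcV j).mul (hcV k)).aestronglyMeasurable (Eventually.of_forall fun ω => ?_)
    rw [Real.norm_eq_abs, abs_mul]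
    exact mul_le_mul (abs_controlCount_le _ _) (abs_controlCount_le _ _) (abs_nonneg _)
      (Nat.cast_nonneg _)
  have hupd : ∀ (v : Fin n → ℝ × Cohort T × EuclideanSpace ℝ (Fin q)) j a,
      (fun i => (Function.update v j a i).2) = Function.update (fun i => (v i).2) j a.2 := by
    intro v j a
    funext i
    by_cases hi : i = j
    · subst hi
      simp
    · simp [hi]
  have hcu : ∀ (z : Fin n → Cohort T × EuclideanSpace ℝ (Fin q)) (j k : Fin n),
      Measurable fun y => controlCount M s (Function.update z j y) k := fun z j k =>
    (measurable_controlCount k).comp (measurable_update z)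
  have hcross : ∀ j k, k ≠ j → ∫ ω,
      (controlCount M s (fun i => (V i ω).2) j * controlCount M s (fun i => (V i ω).2) k) *
      (controlResidual m (V j ω) * controlResidual m (V k ω)) ∂P = 0 := by
    intro j k hkj
    rw [integral_resample hV hind j (F := fun v =>
      (controlCount M s (fun i => (v i).2) j * controlCount M s (fun i => (v i).2) k) *
      (controlResidual m (v j) * controlResidual m (v k))) (by fun_prop) (hprod j k)]
    refine integral_eq_zero_of_ae (Eventually.of_forall fun ω => ?_)
    simp only [hupd, Function.update_self, Function.update_of_ne hkj, hlaw]
    -- With the other units fixed, the product of the two counts is a bounded function of the new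
    -- cohort and covariates of unit `j`, and the residual of unit `k` is a constant.
    have h0 := hμ.mean_zero (fun y =>
      controlCount M s (Function.update (fun i => (V i ω).2) j y) j *
      controlCount M s (Function.update (fun i => (V i ω).2) j y) k)
      ((hcu _ j j).mul (hcu _ j k)) ⟨(n : ℝ) * n, fun y => by
        rw [abs_mul]
        exact mul_le_mul (abs_controlCount_le _ _) (abs_controlCount_le _ _) (abs_nonneg _)
          (Nat.cast_nonneg _)⟩
    simp only [← mul_assoc]
    rw [integral_mul_const, h0, zero_mul]
    rfl
  have hdiag : ∀ j, ∫ ω,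
      (controlCount M s (fun i => (V i ω).2) j * controlCount M s (fun i => (V i ω).2) j) *
      (controlResidual m (V j ω) * controlResidual m (V j ω)) ∂P ≤
      C * ∫ ω, controlCount M s (fun i => (V i ω).2) j ^ 2 ∂P := by
    intro j
    have hsqint : Integrable (fun ω => controlCount M s (fun i => (V i ω).2) j ^ 2) P := by
      refine Integrable.of_bound ((hcV j).pow_const 2).aestronglyMeasurable ((n : ℝ) ^ 2)
        (Eventually.of_forall fun ω => ?_)
      rw [Real.norm_eq_abs, abs_pow]
      exact pow_le_pow_left₀ (abs_nonneg _) (abs_controlCount_le _ _) 2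
    -- Resampling the difference of the two sides reduces the claim to the sign of the inner
    -- integral for each `ω`; the sign passes through the outer integral without any integrability.
    have hF : Measurable fun v : Fin n → ℝ × Cohort T × EuclideanSpace ℝ (Fin q) =>
      (controlCount M s (fun i => (v i).2) j * controlCount M s (fun i => (v i).2) j) *
      (controlResidual m (v j) * controlResidual m (v j)) - C *
        controlCount M s (fun i => (v i).2) j ^ 2 := by fun_prop
    have key := integral_resample hV hind j hF ((hprod j j).sub (hsqint.const_mul C))
    rw [integral_sub (hprod j j) (hsqint.const_mul C), integral_const_mul] at key
    rw [← sub_nonpos, key]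
    refine integral_nonpos fun ω => ?_
    simp only [hupd, Function.update_self, hlaw]
    have hφ : Measurable fun y =>
      controlCount M s (Function.update (fun i => (V i ω).2) j y) j ^ 2 := (hcu _ j j).pow_const 2
    have hbd : ∀ y, |controlCount M s (Function.update (fun i => (V i ω).2) j y) j ^ 2| ≤
        (n : ℝ) ^ 2 := fun y => by
      rw [abs_pow]
      exact pow_le_pow_left₀ (abs_nonneg _) (abs_controlCount_le _ _) 2
    have h1 := hC _ hφ (fun y => by positivity) ⟨(n : ℝ) ^ 2, hbd⟩
    have : IsProbabilityMeasure μ := by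
      rw [← hlaw j]
      exact Measure.isProbabilityMeasure_map (hV j).aemeasurable
    have i2 : Integrable (fun a : ℝ × Cohort T × EuclideanSpace ℝ (Fin q) =>
        controlCount M s (Function.update (fun i => (V i ω).2) j a.2) j ^ 2) μ :=
      Integrable.of_bound (hφ.comp measurable_snd).aestronglyMeasurable ((n : ℝ) ^ 2)
        (Eventually.of_forall fun a => hbd a.2)
    have i1 : Integrable (fun a : ℝ × Cohort T × EuclideanSpace ℝ (Fin q) =>
        controlCount M s (Function.update (fun i => (V i ω).2) j a.2) j ^ 2 *
          controlResidual m a ^ 2) μ :=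
      hμ.integrable_sq.bdd_mul (c := (n : ℝ) ^ 2)
        (hφ.comp measurable_snd).aestronglyMeasurable (Eventually.of_forall fun a => hbd a.2)
    simp only [Pi.zero_apply, ← pow_two]
    rw [integral_sub i1 (i2.const_mul C), integral_const_mul]
    linarith
  have hsq : ∀ ω, (∑ j, controlCount M s (fun i => (V i ω).2) j * controlResidual m (V j ω)) ^ 2 =
      ∑ j, ∑ k,
      (controlCount M s (fun i => (V i ω).2) j * controlCount M s (fun i => (V i ω).2) k) *
      (controlResidual m (V j ω) * controlResidual m (V k ω)) := by
    intro ω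
    rw [pow_two, Finset.sum_mul_sum]
    exact Finset.sum_congr rfl fun j _ => Finset.sum_congr rfl fun k _ => by ring
  have hsqint : ∀ j, Integrable (fun ω => controlCount M s (fun i => (V i ω).2) j ^ 2) P := by
    intro j
    refine Integrable.of_bound ((hcV j).pow_const 2).aestronglyMeasurable ((n : ℝ) ^ 2)
      (Eventually.of_forall fun ω => ?_)
    rw [Real.norm_eq_abs, abs_pow]
    exact pow_le_pow_left₀ (abs_nonneg _) (abs_controlCount_le _ _) 2
  simp only [hsq]
  rw [integral_finsetSum _ fun j _ => integrable_finsetSum _ fun k _ => hprod j k,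
    integral_finsetSum _ fun j _ => hsqint j, Finset.mul_sum]
  refine Finset.sum_le_sum fun j _ => ?_
  rw [integral_finsetSum _ fun k _ => hprod j k,
    Finset.sum_eq_single j (fun k _ hkj => hcross j k hkj) (by simp)]
  exact hdiag j

end Noise

/-! ### Almost sure limits for independent and identically distributed sequences -/

section Sampling

variable {Ω : Type*} [MeasurableSpace Ω] {P : Measure Ω} {β : Type*} [MeasurableSpace β]
  {μ : Measure β} {V : ℕ → Ω → β}

theorem ae_tendsto_average (hV : ∀ i, Measurable (V i)) (hind : iIndepFun V P)
    (hlaw : ∀ i, P.map (V i) = μ) {g : β → ℝ} (hg : Measurable g) (hint : Integrable g μ) :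
    ∀ᵐ ω ∂P, Tendsto (fun n : ℕ => (∑ i : Fin n, g (V i ω)) / n) atTop (𝓝 (∫ a, g a ∂μ)) := by
  have h := strong_law_ae_real (μ := P) (fun i ω => g (V i ω)) ?_ ?_ ?_
  · filter_upwards [h] with ω hω
    rw [← integral_map (f := g) (hV 0).aemeasurable hg.aestronglyMeasurable, hlaw 0] at hω
    simpa only [Finset.sum_range] using hω
  · rw [← hlaw 0, integrable_map_measure hg.aestronglyMeasurable (hV 0).aemeasurable] at hint
    exact hint
  · intro i j hij
    exact (hind.indepFun hij).comp hg hg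
  · intro i
    exact IdentDistrib.comp ⟨(hV i).aemeasurable, (hV 0).aemeasurable, by rw [hlaw i, hlaw 0]⟩ hg

open scoped Classical in
theorem ae_tendsto_frequency [IsProbabilityMeasure μ] (hV : ∀ i, Measurable (V i))
    (hind : iIndepFun V P) (hlaw : ∀ i, P.map (V i) = μ) {B : Set β} (hB : MeasurableSet B) :
    ∀ᵐ ω ∂P, Tendsto (fun n : ℕ =>
      ((Finset.univ.filter fun i : Fin n => V i ω ∈ B).card : ℝ) / n) atTop (𝓝 (μ.real B)) := by
  have h := ae_tendsto_average hV hind hlaw (g := B.indicator fun _ => (1 : ℝ))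
    (measurable_const.indicator hB) ((integrable_const 1).indicator hB)
  filter_upwards [h] with ω hω
  have e : ∫ a, B.indicator (fun _ => (1 : ℝ)) a ∂μ = μ.real B := by
    rw [integral_indicator hB]
    simp
  rw [e] at hω
  simpa [Set.indicator_apply, Finset.sum_boole] using hω

open scoped Classical in
theorem ae_eventually_le_card [IsProbabilityMeasure μ] (hV : ∀ i, Measurable (V i))
    (hind : iIndepFun V P) (hlaw : ∀ i, P.map (V i) = μ) {B : Set β} (hB : MeasurableSet B)
    (hpos : μ B ≠ 0) (M : ℕ) :
    ∀ᵐ ω ∂P, ∀ᶠ n : ℕ in atTop, M ≤ (Finset.univ.filter fun i : Fin n => V i ω ∈ B).card := by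
  filter_upwards [ae_tendsto_frequency hV hind hlaw hB] with ω hω
  have hp : 0 < μ.real B := ENNReal.toReal_pos hpos (measure_ne_top _ _)
  have h := (hω.pos_mul_atTop hp tendsto_natCast_atTop_atTop).eventually_ge_atTop (M : ℝ)
  filter_upwards [h, eventually_gt_atTop 0] with n hn hn0
  rw [div_mul_cancel₀ _ (by positivity)] at hn
  exact_mod_cast hn

/-- Given `X i` and `X j`, a tie puts the independent point `X k` on the sphere around `X i` through
`X j`, a null set. There are countably many triples. -/
theorem ae_forall_dist_ne {E : Type*} [MetricSpace E] [SecondCountableTopology E]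
    [MeasurableSpace E] [BorelSpace E] {ν : Measure E} [IsProbabilityMeasure P]
    {X : ℕ → Ω → E}
    (hX : ∀ i, Measurable (X i)) (hind : iIndepFun X P) (hlaw : ∀ i, P.map (X i) = ν)
    (hν : ∀ x r, ν (Metric.sphere x r) = 0) :
    ∀ᵐ ω ∂P, ∀ i j k, i ≠ k → j ≠ k → dist (X k ω) (X i ω) ≠ dist (X j ω) (X i ω) := by
  simp only [ae_all_iff]
  intro i j k hik hjk
  have hpair : Measurable fun ω => (X i ω, X j ω) := (hX i).prodMk (hX j)
  have hmap := (indepFun_iff_map_prod_eq_prod_map_map hpair.aemeasurable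
    (hX k).aemeasurable).1 (hind.indepFun_prodMk hX i j k hik hjk)
  have hB : MeasurableSet {p : (E × E) × E | dist p.2 p.1.1 = dist p.1.2 p.1.1} :=
    measurableSet_eq_fun (by fun_prop) (by fun_prop)
  have : IsProbabilityMeasure (P.map (X k)) := Measure.isProbabilityMeasure_map (hX k).aemeasurable
  have h0 : (P.map fun ω => ((X i ω, X j ω), X k ω))
      {p : (E × E) × E | dist p.2 p.1.1 = dist p.1.2 p.1.1} = 0 := by
    rw [hmap, Measure.measure_prod_null hB]
    refine Eventually.of_forall fun p => ?_
    rw [hlaw k]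
    exact hν p.1 (dist p.2 p.1)
  rw [Measure.map_apply (hpair.prodMk (hX k)) hB] at h0
  exact measure_eq_zero_iff_ae_notMem.1 h0

end Sampling

/-! ### Asymptotics of nearest neighbor matching -/

section MatchingAsymptotics

variable {Ω : Type*} [MeasurableSpace Ω] {P : Measure Ω} [IsProbabilityMeasure P] {T q : ℕ}
  {s : Cohort T} {m : EuclideanSpace ℝ (Fin q) → ℝ}
  {μ : Measure (ℝ × Cohort T × EuclideanSpace ℝ (Fin q))}
  {V : ℕ → Ω → ℝ × Cohort T × EuclideanSpace ℝ (Fin q)}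

theorem isProbabilityMeasure_of_map_eq (hV : ∀ i, Measurable (V i))
    (hlaw : ∀ i, P.map (V i) = μ) : IsProbabilityMeasure μ := by
  rw [← hlaw 0]
  exact Measure.isProbabilityMeasure_map (hV 0).aemeasurable

theorem measurableSet_cohort (c : Cohort T) :
    MeasurableSet {a : ℝ × Cohort T × EuclideanSpace ℝ (Fin q) | a.2.1 = c} :=
  (measurable_fst.comp measurable_snd) (measurableSet_singleton c)

theorem measurableSet_covariate {B : Set (EuclideanSpace ℝ (Fin q))} (hB : MeasurableSet B) :
    MeasurableSet {a : ℝ × Cohort T × EuclideanSpace ℝ (Fin q) | a.2.2 ∈ B} :=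
  (measurable_snd.comp measurable_snd) hB

open scoped Classical in
-- Uniformity in `x` comes from compactness: finitely many balls of radius ε/2 cover `S`, each
-- eventually contains M controls, and the ε-ball around `x` contains the covering ball in which `x`
-- lies.
theorem ae_eventually_le_card_control (hV : ∀ i, Measurable (V i)) (hind : iIndepFun V P)
    (hlaw : ∀ i, P.map (V i) = μ) {S : Set (EuclideanSpace ℝ (Fin q))} (hS : IsCompact S)
    (hpos : ∀ x ∈ S, ∀ ε > 0, μ {a | a.2.1 = ⊤ ∧ a.2.2 ∈ Metric.ball x ε} ≠ 0)
    (M : ℕ) {ε : ℝ} (hε : 0 < ε) :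
    ∀ᵐ ω ∂P, ∀ᶠ n : ℕ in atTop, ∀ x ∈ S,
      M ≤ (Finset.univ.filter fun j : Fin n =>
        (V j ω).2.1 = ⊤ ∧ ‖(V j ω).2.2 - x‖ ≤ ε).card := by
  have := isProbabilityMeasure_of_map_eq hV hlaw
  obtain ⟨t, htS, hcover⟩ := hS.elim_nhds_subcover (fun x => Metric.ball x (ε / 2))
    fun x _ => Metric.ball_mem_nhds x (half_pos hε)
  have h : ∀ᵐ ω ∂P, ∀ y ∈ t, ∀ᶠ n : ℕ in atTop, M ≤ (Finset.univ.filter fun j : Fin n =>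
      V j ω ∈ {a | a.2.1 = ⊤ ∧ a.2.2 ∈ Metric.ball y (ε / 2)}).card := by
    refine (ae_ball_iff t.countable_toSet).2 fun y hy => ?_
    filter_upwards [ae_eventually_le_card hV hind hlaw
      (B := {a | a.2.1 = ⊤ ∧ a.2.2 ∈ Metric.ball y (ε / 2)})
      ((measurableSet_cohort ⊤).inter (measurableSet_covariate measurableSet_ball))
      (hpos y (htS y hy) _ (half_pos hε)) M] with ω hω
    convert hω
  filter_upwards [h] with ω hω
  filter_upwards [(t.eventually_all).2 hω] with n hn x hx
  obtain ⟨y, hy, hxy⟩ := Set.mem_iUnion₂.1 (hcover hx)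
  refine (hn y hy).trans (Finset.card_le_card fun j hj => ?_)
  simp only [Finset.mem_filter, Finset.mem_univ, true_and] at hj ⊢
  refine ⟨hj.1, ?_⟩
  have h1 : dist (V j ω).2.2 y < ε / 2 := hj.2
  have h2 : dist x y < ε / 2 := hxy
  rw [← dist_eq_norm]
  linarith [dist_triangle_right (V j ω).2.2 x y]

open scoped Classical in
-- Without atoms each point has a radius `r` such that the ball of radius 2r has mass below δ.
-- Finitely many balls of radius `r` cover `S`, and ε is the smallest of these radii, so every
-- ε-ball centred in `S` lies in one of the doubled balls.
theorem ae_eventually_card_ball_le (hV : ∀ i, Measurable (V i)) (hind : iIndepFun V P)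
    (hlaw : ∀ i, P.map (V i) = μ) {S : Set (EuclideanSpace ℝ (Fin q))} (hS : IsCompact S)
    (hnull : ∀ x r, μ {a | dist a.2.2 x = r} = 0) {δ : ℝ} (hδ : 0 < δ) :
    ∃ ε > 0, ∀ᵐ ω ∂P, ∀ᶠ n : ℕ in atTop, ∀ x ∈ S,
      ((Finset.univ.filter fun j : Fin n => ‖(V j ω).2.2 - x‖ ≤ ε).card : ℝ) ≤ δ * n := by
  have := isProbabilityMeasure_of_map_eq hV hlaw
  have hX : Measurable fun a : ℝ × Cohort T × EuclideanSpace ℝ (Fin q) => a.2.2 := by fun_prop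
  have : IsProbabilityMeasure (μ.map fun a => a.2.2) :=
    Measure.isProbabilityMeasure_map hX.aemeasurable
  have hsmall : ∀ x : EuclideanSpace ℝ (Fin q), ∃ r > 0,
      μ.real {a | a.2.2 ∈ Metric.ball x (2 * r)} < δ := by
    intro x
    have h0 : (μ.map fun a => a.2.2) {x} < ENNReal.ofReal δ := by
      rw [Measure.map_apply hX (measurableSet_singleton x)]
      -- The sphere of radius 0 is the point itself.
      have := hnull x 0
      simp only [dist_eq_zero] at this
      rw [show ((fun a : ℝ × Cohort T × EuclideanSpace ℝ (Fin q) => a.2.2) ⁻¹' {x}) =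
        {a | a.2.2 = x} from rfl, this]
      exact ENNReal.ofReal_pos.2 hδ
    obtain ⟨U, hxU, hU, hUδ⟩ := Set.exists_isOpen_lt_of_lt _ _ h0
    obtain ⟨r, hr, hrU⟩ := Metric.isOpen_iff.1 hU x (hxU rfl)
    refine ⟨r / 2, half_pos hr, ?_⟩
    rw [mul_div_cancel₀ r two_ne_zero]
    refine (ENNReal.lt_ofReal_iff_toReal_lt (measure_ne_top _ _)).1 (lt_of_le_of_lt ?_ hUδ)
    rw [Measure.map_apply hX hU.measurableSet]
    exact measure_mono fun a ha => hrU ha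
  choose r hr hrδ using hsmall
  obtain ⟨t, -, hcover⟩ := hS.elim_nhds_subcover (fun x => Metric.ball x (r x))
    fun x _ => Metric.ball_mem_nhds x (hr x)
  obtain ⟨ε, hε, hεt⟩ : ∃ ε > 0, ∀ y ∈ t, ε ≤ r y := by
    rcases t.eq_empty_or_nonempty with rfl | ht
    · exact ⟨1, one_pos, by simp⟩
    · obtain ⟨y, hy, hmin⟩ := t.exists_min_image r ht
      exact ⟨r y, hr y, hmin⟩
  refine ⟨ε, hε, ?_⟩
  have h : ∀ᵐ ω ∂P, ∀ y ∈ t, ∀ᶠ n : ℕ in atTop, ((Finset.univ.filter fun j : Fin n =>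
      V j ω ∈ {a | a.2.2 ∈ Metric.ball y (2 * r y)}).card : ℝ) / n < δ := by
    refine (ae_ball_iff t.countable_toSet).2 fun y _ => ?_
    filter_upwards [ae_tendsto_frequency hV hind hlaw
      (measurableSet_covariate (T := T) (measurableSet_ball (x := y) (ε := 2 * r y)))]
      with ω hω
    exact hω.eventually_lt_const (hrδ y)
  filter_upwards [h] with ω hω
  filter_upwards [(t.eventually_all).2 hω, eventually_gt_atTop 0] with n hn hn0 x hx
  obtain ⟨y, hy, hxy⟩ := Set.mem_iUnion₂.1 (hcover hx)
  have hn0' : (0 : ℝ) < n := Nat.cast_pos.2 hn0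
  refine le_trans ?_ ((div_lt_iff₀ hn0').1 (hn y hy)).le
  refine Nat.cast_le.2 (Finset.card_le_card fun j hj => ?_)
  simp only [Finset.mem_filter, Finset.mem_univ, true_and] at hj ⊢
  rw [← dist_eq_norm] at hj
  have h2 : dist x y < r y := hxy
  have h3 := hεt y hy
  change dist (V j ω).2.2 y < 2 * r y
  linarith [dist_triangle (V j ω).2.2 x y]

/-- For large n matches are within ε, so the units that use `j` as a match lie in the ε-ball around
its covariates, which holds at most δ n units. -/
theorem ae_eventually_controlCount_le (hμ : MatchingModel μ s m) (hV : ∀ i, Measurable (V i))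
    (hind : iIndepFun V P) (hlaw : ∀ i, P.map (V i) = μ) (M : ℕ) {δ : ℝ} (hδ : 0 < δ) :
    ∀ᵐ ω ∂P, ∀ᶠ n : ℕ in atTop, ∀ j : Fin n,
      controlCount M s (fun i : Fin n => (V i ω).2) j ≤ δ * n := by
  classical
  obtain ⟨S, hS, hmem, hpos⟩ := hμ.support
  obtain ⟨ε, hε, hball⟩ := ae_eventually_card_ball_le hV hind hlaw hS hμ.sphere_null hδ
  have hXS : ∀ᵐ ω ∂P, ∀ i, (V i ω).2.2 ∈ S := by
    refine ae_all_iff.2 fun i => ?_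
    rw [← hlaw i] at hmem
    exact ae_of_ae_map (hV i).aemeasurable hmem
  filter_upwards [hball, hXS, ae_eventually_le_card_control hV hind hlaw hS hpos M hε]
    with ω h1 h2 h3
  filter_upwards [h1, h3] with n h1 h3 j
  rw [controlCount]
  split_ifs with hj
  · refine le_trans (Nat.cast_le.2 ?_) (h1 _ (h2 j))
    rw [matchCount_eq hj]
    refine Finset.card_le_card fun l hl => ?_
    simp only [Finset.mem_filter, Finset.mem_univ, true_and] at hl ⊢
    rw [norm_sub_rev]
    exact norm_sub_le_of_mem_neighborFinset (h3 _ (h2 l)) hl.2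
  · positivity

/-- The sum of squares is at most the largest count times the sum of the counts, that is δ n · M n
for every δ > 0. -/
theorem ae_tendsto_sum_controlCount_sq (hμ : MatchingModel μ s m) (hV : ∀ i, Measurable (V i))
    (hind : iIndepFun V P) (hlaw : ∀ i, P.map (V i) = μ) (M : ℕ) :
    ∀ᵐ ω ∂P, Tendsto (fun n : ℕ =>
      (∑ j : Fin n, controlCount M s (fun i : Fin n => (V i ω).2) j ^ 2) / (n : ℝ) ^ 2)
      atTop (𝓝 0) := by
  have h : ∀ᵐ ω ∂P, ∀ k : ℕ, ∀ᶠ n : ℕ in atTop, ∀ j : Fin n,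
      controlCount M s (fun i : Fin n => (V i ω).2) j ≤ (1 / ((k : ℝ) + 1)) * n :=
    ae_all_iff.2 fun k => ae_eventually_controlCount_le hμ hV hind hlaw M (by positivity)
  filter_upwards [h] with ω hω
  rw [Metric.tendsto_nhds]
  intro η hη
  obtain ⟨k, hk⟩ := exists_nat_one_div_lt (show 0 < η / (M + 1) by positivity)
  filter_upwards [hω k, eventually_gt_atTop 0] with n hn hn0
  have hn0' : (0 : ℝ) < n := Nat.cast_pos.2 hn0
  have hnn : 0 ≤ ∑ j : Fin n, controlCount M s (fun i : Fin n => (V i ω).2) j ^ 2 :=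
    Finset.sum_nonneg fun j _ => sq_nonneg _
  rw [Real.dist_0_eq_abs, abs_of_nonneg (by positivity), div_lt_iff₀ (by positivity)]
  calc ∑ j : Fin n, controlCount M s (fun i : Fin n => (V i ω).2) j ^ 2
      ≤ ∑ j : Fin n, (1 / ((k : ℝ) + 1) * n) * controlCount M s (fun i : Fin n => (V i ω).2) j :=
        Finset.sum_le_sum fun j _ => by
          rw [pow_two]
          exact mul_le_mul_of_nonneg_right (hn j) (controlCount_nonneg _ _)
    _ ≤ (1 / ((k : ℝ) + 1) * n) * (M * n) := by
        rw [← Finset.mul_sum]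
        exact mul_le_mul_of_nonneg_left (sum_controlCount_le _) (by positivity)
    _ = (1 / ((k : ℝ) + 1)) * M * (n : ℝ) ^ 2 := by ring
    _ < η * (n : ℝ) ^ 2 := by
        refine mul_lt_mul_of_pos_right ?_ (by positivity)
        calc (1 / ((k : ℝ) + 1)) * M ≤ (1 / ((k : ℝ) + 1)) * (M + 1) := by gcongr; linarith
          _ < η := (lt_div_iff₀ (by positivity)).1 hk

/-- The contribution of the residuals of the matched controls, divided by the sample size. -/
noncomputable def matchingNoise (M : ℕ) (s : Cohort T) (m : EuclideanSpace ℝ (Fin q) → ℝ)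
    (V : ℕ → Ω → ℝ × Cohort T × EuclideanSpace ℝ (Fin q)) (n : ℕ) (ω : Ω) : ℝ :=
  (∑ j : Fin n, controlCount M s (fun i : Fin n => (V i ω).2) j * controlResidual m (V j ω)) / n

/-- Convergence holds in L². The almost sure limit of ∑_j K_j² / n² passes to expectations by
dominated convergence, with the bound M from K_j ≤ n and ∑_j K_j ≤ M n. -/
theorem tendstoInMeasure_matchingNoise (hμ : MatchingModel μ s m) (hV : ∀ i, Measurable (V i))
    (hind : iIndepFun V P) (hlaw : ∀ i, P.map (V i) = μ) (M : ℕ) :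
    TendstoInMeasure P (matchingNoise M s m V) atTop (fun _ => 0) := by
  obtain ⟨K, hK⟩ := hμ.lipschitz
  have he : Measurable (controlResidual (T := T) m) :=
    measurable_controlResidual hK.continuous.measurable
  have hcV : ∀ (n : ℕ) (j : Fin n),
      Measurable fun ω => controlCount M s (fun i : Fin n => (V i ω).2) j := fun n j =>
    (measurable_controlCount j).comp
      (measurable_pi_lambda _ fun i => measurable_snd.comp (hV i))
  have heV : ∀ i, Measurable fun ω => controlResidual m (V i ω) := fun i => he.comp (hV i)
  have hNm : ∀ n, Measurable (matchingNoise M s m V n) := fun n => by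
    unfold matchingNoise
    exact (Finset.measurable_sum _ fun j _ => (hcV n j).mul (heV j)).div_const _
  obtain ⟨C, hC0, hC⟩ := hμ.variance_le
  have hL2 : ∀ i, MemLp (fun ω => controlResidual m (V i ω)) 2 P := by
    intro i
    refine (memLp_two_iff_integrable_sq (heV i).aestronglyMeasurable).2 ?_
    have := hμ.integrable_sq
    rw [← hlaw i, integrable_map_measure (he.pow_const 2).aestronglyMeasurable
      (hV i).aemeasurable] at this
    exact this
  have hNL2 : ∀ n, MemLp (matchingNoise M s m V n) 2 P := by
    intro n
    have : MemLp (fun ω => ∑ j : Fin n,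
        controlCount M s (fun i : Fin n => (V i ω).2) j * controlResidual m (V j ω)) 2 P := by
      refine memLp_finsetSum _ fun j _ => ?_
      refine (hL2 j).of_le_mul (c := n) ((hcV n j).mul (heV j)).aestronglyMeasurable
        (Eventually.of_forall fun ω => ?_)
      rw [norm_mul]
      exact mul_le_mul_of_nonneg_right (abs_controlCount_le _ _) (norm_nonneg _)
    have h2 := this.const_mul ((n : ℝ)⁻¹)
    refine h2.congr_norm (hNm n).aestronglyMeasurable (Eventually.of_forall fun ω => ?_)
    simp only [matchingNoise, div_eq_inv_mul]
  set R : ℕ → Ω → ℝ := fun n ω =>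
    (∑ j : Fin n, controlCount M s (fun i : Fin n => (V i ω).2) j ^ 2) / (n : ℝ) ^ 2 with hR
  have hsecond : ∀ n, ∫ ω, matchingNoise M s m V n ω ^ 2 ∂P ≤ C * ∫ ω, R n ω ∂P := by
    intro n
    have h := integral_controlCount_sq_le (P := P) (M := M) (V := fun i : Fin n => V i) hμ hC
      (fun i => hV i) (hind.precomp Fin.val_injective) (fun i => hlaw i)
    have e1 : ∫ ω, matchingNoise M s m V n ω ^ 2 ∂P = (∫ ω, (∑ j : Fin n,
        controlCount M s (fun i : Fin n => (V i ω).2) j * controlResidual m (V j ω)) ^ 2 ∂P) /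
        (n : ℝ) ^ 2 := by
      rw [← integral_div]
      simp only [matchingNoise, div_pow]
    have e2 : ∫ ω, R n ω ∂P =
        (∫ ω, ∑ j : Fin n, controlCount M s (fun i : Fin n => (V i ω).2) j ^ 2 ∂P) /
        (n : ℝ) ^ 2 := by
      rw [← integral_div]
    rw [e1, e2, ← mul_div_assoc]
    exact div_le_div_of_nonneg_right h (sq_nonneg _)
  have hRlim : Tendsto (fun n => ∫ ω, R n ω ∂P) atTop (𝓝 0) := by
    have : Tendsto (fun n => ∫ ω, R n ω ∂P) atTop (𝓝 (∫ _, (0 : ℝ) ∂P)) := by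
      refine tendsto_integral_of_dominated_convergence (fun _ => (M : ℝ)) (fun n => ?_)
        (integrable_const _) (fun n => Eventually.of_forall fun ω => ?_)
        (ae_tendsto_sum_controlCount_sq hμ hV hind hlaw M)
      · exact ((Finset.measurable_sum _ fun j _ => (hcV n j).pow_const 2).div_const
          _).aestronglyMeasurable
      · rcases Nat.eq_zero_or_pos n with rfl | hn
        · simp [hR]
        have hn0' : (0 : ℝ) < n := Nat.cast_pos.2 hn
        have hnn : 0 ≤ ∑ j : Fin n, controlCount M s (fun i : Fin n => (V i ω).2) j ^ 2 :=
          Finset.sum_nonneg fun j _ => sq_nonneg _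
        rw [Real.norm_eq_abs, abs_of_nonneg (by positivity), div_le_iff₀ (by positivity)]
        calc ∑ j : Fin n, controlCount M s (fun i : Fin n => (V i ω).2) j ^ 2
            ≤ ∑ j : Fin n, n * controlCount M s (fun i : Fin n => (V i ω).2) j :=
              Finset.sum_le_sum fun j _ => by
                rw [pow_two]
                exact mul_le_mul_of_nonneg_right (controlCount_le _ _) (controlCount_nonneg _ _)
          _ ≤ n * (M * n) := by
              rw [← Finset.mul_sum]
              exact mul_le_mul_of_nonneg_left (sum_controlCount_le _) (by positivity)
          _ = M * (n : ℝ) ^ 2 := by ring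
    simpa using this
  have hsqlim : Tendsto (fun n => ∫ ω, matchingNoise M s m V n ω ^ 2 ∂P) atTop (𝓝 0) := by
    refine squeeze_zero (fun n => integral_nonneg fun ω => sq_nonneg _) hsecond ?_
    simpa using hRlim.const_mul C
  refine tendstoInMeasure_of_tendsto_eLpNorm (p := 2) (by simp)
    (fun n => (hNm n).aestronglyMeasurable) aestronglyMeasurable_const ?_
  have e : ∀ n, eLpNorm (matchingNoise M s m V n - fun _ => 0) 2 P =
      ENNReal.ofReal ((∫ ω, matchingNoise M s m V n ω ^ 2 ∂P) ^ (2⁻¹ : ℝ)) := by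
    intro n
    have : (matchingNoise M s m V n - fun _ => 0) = matchingNoise M s m V n := by
      funext ω
      simp
    rw [this, (hNL2 n).eLpNorm_eq_integral_rpow_norm (by simp) (by simp)]
    simp
  simp only [e]
  have : Tendsto (fun n => (∫ ω, matchingNoise M s m V n ω ^ 2 ∂P) ^ (2⁻¹ : ℝ)) atTop (𝓝 0) := by
    have h := hsqlim.rpow_const (p := (2⁻¹ : ℝ)) (Or.inr (by norm_num))
    rwa [Real.zero_rpow (by norm_num)] at h
  simpa using ENNReal.tendsto_ofReal this

end MatchingAsymptotics

/-! ### Consistency of the matched difference in means -/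

section MatchedDifference

open scoped Classical

variable {n T q M : ℕ} {ts : Fin n → Cohort T} {X : Fin n → EuclideanSpace ℝ (Fin q)}
  {s s' : Cohort T}

/-- Each unit of cohort `s` hands out M shares of size 1/M. This equates the total weights of the
two groups. -/
theorem sum_matchCount_div (hM : M ≠ 0)
    (hcard : ∀ l, ts l = s → (neighborFinset M ts X l s').card = M) :
    ∑ j with ts j = s', (matchCount M ts X j s : ℝ) / M =
      (Finset.univ.filter fun l => ts l = s).card := by
  have hM' : (M : ℝ) ≠ 0 := Nat.cast_ne_zero.2 hM
  simp only [div_eq_mul_inv]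
  rw [sum_matchCount_mul s fun _ => (M : ℝ)⁻¹]
  rw [Finset.sum_congr rfl fun l hl => by
    rw [Finset.sum_const, hcard l (Finset.mem_filter.1 hl).2, nsmul_eq_mul, mul_inv_cancel₀ hM']]
  simp

/-- By double counting, the left side compares m at each treated unit with the average of m over its
M matches, all within ε. -/
theorem abs_matched_sub_le (hM : M ≠ 0) {m : EuclideanSpace ℝ (Fin q) → ℝ} {K : NNReal}
    (hK : LipschitzWith K m) {ε : ℝ}
    (hcard : ∀ l, ts l = s → (neighborFinset M ts X l s').card = M)
    (hnear : ∀ l, ts l = s → ∀ j ∈ neighborFinset M ts X l s', ‖X j - X l‖ ≤ ε) :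
    |∑ j with ts j = s', (matchCount M ts X j s : ℝ) / M * m (X j)
        - ∑ l with ts l = s, m (X l)| ≤
      (Finset.univ.filter fun l => ts l = s).card * (K * ε) := by
  have hM' : (0 : ℝ) < M := Nat.cast_pos.2 (Nat.pos_of_ne_zero hM)
  have e : ∑ j with ts j = s', (matchCount M ts X j s : ℝ) / M * m (X j)
        - ∑ l with ts l = s, m (X l) =
      ∑ l with ts l = s, ∑ j ∈ neighborFinset M ts X l s', (m (X j) - m (X l)) / M := by
    have h := sum_matchCount_mul (M := M) (X := X) (ts := ts) (s' := s') s fun j => m (X j) / M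
    rw [Finset.sum_congr (g := fun j => (matchCount M ts X j s : ℝ) * (m (X j) / M)) rfl
      fun j _ => by ring, h, ← Finset.sum_sub_distrib]
    refine Finset.sum_congr rfl fun l hl => ?_
    simp only [sub_div, Finset.sum_sub_distrib, Finset.sum_const,
      hcard l (Finset.mem_filter.1 hl).2, nsmul_eq_mul]
    field_simp
  rw [e]
  refine (Finset.abs_sum_le_sum_abs _ _).trans ?_
  rw [← nsmul_eq_mul, ← Finset.sum_const]
  refine Finset.sum_le_sum fun l hl => ?_
  have hl' := (Finset.mem_filter.1 hl).2
  refine (Finset.abs_sum_le_sum_abs _ _).trans ?_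
  calc ∑ j ∈ neighborFinset M ts X l s', |(m (X j) - m (X l)) / M|
      ≤ ∑ j ∈ neighborFinset M ts X l s', K * ε / M := by
        refine Finset.sum_le_sum fun j hj => ?_
        rw [abs_div, abs_of_pos hM']
        refine div_le_div_of_nonneg_right ?_ hM'.le
        refine (hK.dist_le_mul (X j) (X l)).trans ?_
        rw [dist_eq_norm]
        exact mul_le_mul_of_nonneg_left (hnear l hl' j hj) K.2
    _ = K * ε := by
        rw [Finset.sum_const, hcard l hl', nsmul_eq_mul]
        field_simp

end MatchedDifference

section Consistency

open scoped Classical in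
/-- The difference between the mean outcome of cohort `s` and the mean outcome of its matched
controls. -/
noncomputable def matchedDifference {n T q : ℕ} (M : ℕ) (s : Cohort T)
    (v : Fin n → ℝ × Cohort T × EuclideanSpace ℝ (Fin q)) : ℝ :=
  (∑ i with (v i).2.1 = s, (v i).1 - ∑ i with (v i).2.1 = ⊤,
      (matchCount M (fun i => (v i).2.1) (fun i => (v i).2.2) i s : ℝ) / M * (v i).1) /
    (Finset.univ.filter fun i => (v i).2.1 = s).card

variable {Ω : Type*} [MeasurableSpace Ω] {P : Measure Ω} [IsProbabilityMeasure P] {T q : ℕ}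
  {s : Cohort T} {m : EuclideanSpace ℝ (Fin q) → ℝ}
  {μ : Measure (ℝ × Cohort T × EuclideanSpace ℝ (Fin q))}
  {V : ℕ → Ω → ℝ × Cohort T × EuclideanSpace ℝ (Fin q)}

/-- Almost surely, the units of cohort `s` eventually have exactly `M` matches, all of them
close. -/
theorem ae_eventually_matches (hμ : MatchingModel μ s m) (hs : s ≠ ⊤)
    (hV : ∀ i, Measurable (V i))
    (hind : iIndepFun V P) (hlaw : ∀ i, P.map (V i) = μ) (M : ℕ) {ε : ℝ} (hε : 0 < ε) :
    ∀ᵐ ω ∂P, ∀ᶠ n : ℕ in atTop, ∀ l : Fin n, (V l ω).2.1 = s →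
      (neighborFinset M (fun i : Fin n => (V i ω).2.1) (fun i => (V i ω).2.2) l ⊤).card = M ∧
      ∀ j ∈ neighborFinset M (fun i : Fin n => (V i ω).2.1) (fun i => (V i ω).2.2) l ⊤,
        ‖(V j ω).2.2 - (V l ω).2.2‖ ≤ ε := by
  classical
  obtain ⟨S, hS, hmem, hpos⟩ := hμ.support
  have hX : Measurable fun a : ℝ × Cohort T × EuclideanSpace ℝ (Fin q) => a.2.2 := by fun_prop
  have hXS : ∀ᵐ ω ∂P, ∀ i, (V i ω).2.2 ∈ S := by
    refine ae_all_iff.2 fun i => ?_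
    rw [← hlaw i] at hmem
    exact ae_of_ae_map (hV i).aemeasurable hmem
  have hties := ae_forall_dist_ne (P := P) (ν := μ.map fun a => a.2.2)
    (X := fun i ω => (V i ω).2.2) (fun i => hX.comp (hV i)) (hind.comp _ fun _ => hX)
    (fun i => by
      rw [← hlaw i, Measure.map_map hX (hV i)]
      rfl)
    (fun x r => by
      rw [Measure.map_apply hX Metric.isClosed_sphere.measurableSet]
      exact hμ.sphere_null x r)
  filter_upwards [hXS, hties, ae_eventually_le_card_control hV hind hlaw hS hpos M hε]
    with ω h1 h2 h3
  filter_upwards [h3] with n h3 l hl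
  have h4 := h3 _ (h1 l)
  refine ⟨card_neighborFinset_eq (fun j k hj hk hjk => ?_) (h4.trans (Finset.card_le_card
    fun j hj => ?_)), fun j hj => norm_sub_le_of_mem_neighborFinset h4 hj⟩
  · by_contra hne
    -- The absence of ties needs `l ≠ k`, which holds because `l` is in cohort `s ≠ ⊤` and `k` is
    -- never-treated.
    refine h2 l j k (fun h => hs ?_) (fun h => hne (Fin.ext h)) ?_
    · rw [← hl, ← hk, Fin.ext h]
    · rw [dist_eq_norm, dist_eq_norm]
      exact hjk.symm
  · simp only [Finset.mem_filter, Finset.mem_univ, true_and] at hj ⊢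
    exact hj.1

open scoped Classical in
-- Adding back the noise replaces the outcomes of the controls by their regression values. What
-- remains is the mean of Z - m(X) over cohort `s` minus the matching bias, and both converge almost
-- surely.
theorem ae_tendsto_matchedDifference_add (hμ : MatchingModel μ s m) (hs : s ≠ ⊤)
    (hV : ∀ i, Measurable (V i))
    (hind : iIndepFun V P) (hlaw : ∀ i, P.map (V i) = μ) {M : ℕ} (hM : M ≠ 0) :
    ∀ᵐ ω ∂P, Tendsto (fun n : ℕ => matchedDifference M s (fun i : Fin n => V i ω) +
        ((Finset.univ.filter fun i : Fin n => (V i ω).2.1 = s).card / (n : ℝ))⁻¹ *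
          (matchingNoise M s m V n ω / M)) atTop
      (𝓝 ((∫ a in {a | a.2.1 = s}, (a.1 - m a.2.2) ∂μ) / μ.real {a | a.2.1 = s})) := by
  have := isProbabilityMeasure_of_map_eq hV hlaw
  obtain ⟨K, hK⟩ := hμ.lipschitz
  have hm : Measurable m := hK.continuous.measurable
  have hM' : (M : ℝ) ≠ 0 := Nat.cast_ne_zero.2 hM
  have hBs : MeasurableSet {a : ℝ × Cohort T × EuclideanSpace ℝ (Fin q) | a.2.1 = s} :=
    measurableSet_cohort s
  have hp : 0 < μ.real {a | a.2.1 = s} :=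
    ENNReal.toReal_pos hμ.treated_ne_zero (measure_ne_top _ _)
  have hslln := ae_tendsto_average hV hind hlaw
    (g := Set.indicator {a : ℝ × Cohort T × EuclideanSpace ℝ (Fin q) | a.2.1 = s}
      fun a => a.1 - m a.2.2)
    ((by fun_prop : Measurable fun a : ℝ × Cohort T × EuclideanSpace ℝ (Fin q) =>
      a.1 - m a.2.2).indicator hBs) (hμ.integrable_residual.indicator hBs)
  rw [integral_indicator hBs] at hslln
  have hnear : ∀ᵐ ω ∂P, ∀ k : ℕ, ∀ᶠ n : ℕ in atTop, ∀ l : Fin n, (V l ω).2.1 = s →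
      (neighborFinset M (fun i : Fin n => (V i ω).2.1) (fun i => (V i ω).2.2) l ⊤).card = M ∧
      ∀ j ∈ neighborFinset M (fun i : Fin n => (V i ω).2.1) (fun i => (V i ω).2.2) l ⊤,
        ‖(V j ω).2.2 - (V l ω).2.2‖ ≤ 1 / ((k : ℝ) + 1) :=
    ae_all_iff.2 fun k => ae_eventually_matches hμ hs hV hind hlaw M (by positivity)
  filter_upwards [hslln, hnear, ae_tendsto_frequency hV hind hlaw hBs] with ω h1 h2 h3
  replace h3 : Tendsto (fun n : ℕ =>
      ((Finset.univ.filter fun i : Fin n => (V i ω).2.1 = s).card : ℝ) / n) atTop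
      (𝓝 (μ.real {a | a.2.1 = s})) := by
    convert h3
  have hpos : ∀ᶠ n : ℕ in atTop,
      (0 : ℝ) < (Finset.univ.filter fun i : Fin n => (V i ω).2.1 = s).card := by
    filter_upwards [h3.eventually_const_lt hp] with n hn
    by_contra hc
    rw [not_lt] at hc
    exact absurd hn (not_lt.2 (div_nonpos_of_nonpos_of_nonneg hc (Nat.cast_nonneg n)))
  set bias : ℕ → ℝ := fun n => (∑ j ∈ Finset.univ.filter (fun j : Fin n => (V j ω).2.1 = ⊤),
      (matchCount M (fun i : Fin n => (V i ω).2.1) (fun i => (V i ω).2.2) j s : ℝ) / M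
        * m (V j ω).2.2 - ∑ l ∈ Finset.univ.filter (fun l : Fin n => (V l ω).2.1 = s), m (V l ω).2.2) /
      (Finset.univ.filter fun i : Fin n => (V i ω).2.1 = s).card with hbias
  have hbias0 : Tendsto bias atTop (𝓝 0) := by
    rw [Metric.tendsto_nhds]
    intro η hη
    obtain ⟨k, hk⟩ := exists_nat_one_div_lt (show 0 < η / (K + 1) by positivity)
    filter_upwards [h2 k, hpos] with n hn hn0
    have h := abs_matched_sub_le (M := M) (ts := fun i : Fin n => (V i ω).2.1)
      (X := fun i => (V i ω).2.2) hM hK (fun l hl => (hn l hl).1) (fun l hl => (hn l hl).2)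
    rw [Real.dist_0_eq_abs, hbias, abs_div, abs_of_pos hn0, div_lt_iff₀ hn0]
    refine h.trans_lt ?_
    rw [mul_comm]
    refine mul_lt_mul_of_pos_right ?_ hn0
    have hk' := (lt_div_iff₀ (by positivity)).1 hk
    have : 0 < 1 / ((k : ℝ) + 1) := by positivity
    nlinarith
  have hlim := (h3.inv₀ hp.ne').mul h1 |>.sub hbias0
  rw [sub_zero, inv_mul_eq_div] at hlim
  refine hlim.congr' ?_
  filter_upwards [hpos, eventually_gt_atTop 0] with n hn hn0
  have hn0' : (n : ℝ) ≠ 0 := by positivity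
  have e1 : ∑ i : Fin n, Set.indicator {a : ℝ × Cohort T × EuclideanSpace ℝ (Fin q) | a.2.1 = s}
      (fun a => a.1 - m a.2.2) (V i ω) =
      ∑ i ∈ Finset.univ.filter (fun i : Fin n => (V i ω).2.1 = s), (V i ω).1
        - ∑ i ∈ Finset.univ.filter (fun i : Fin n => (V i ω).2.1 = s), m (V i ω).2.2 := by
    rw [← Finset.sum_sub_distrib, Finset.sum_filter]
    refine Finset.sum_congr rfl fun i _ => ?_
    rw [Set.indicator_apply]
    rfl
  have e2 : matchingNoise M s m V n ω / M = (∑ j ∈ Finset.univ.filter (fun j : Fin n => (V j ω).2.1 = ⊤),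
      (matchCount M (fun i : Fin n => (V i ω).2.1) (fun i => (V i ω).2.2) j s : ℝ) / M
        * (V j ω).1 - ∑ j ∈ Finset.univ.filter (fun j : Fin n => (V j ω).2.1 = ⊤),
      (matchCount M (fun i : Fin n => (V i ω).2.1) (fun i => (V i ω).2.2) j s : ℝ) / M
        * m (V j ω).2.2) / n := by
    rw [matchingNoise, ← Finset.sum_sub_distrib, Finset.sum_filter, div_right_comm,
      Finset.sum_div]
    congr 1
    refine Finset.sum_congr rfl fun j _ => ?_
    rw [controlCount, controlResidual]
    split_ifs <;> ring
  rw [e1, e2, hbias, matchedDifference]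
  field_simp
  ring

open scoped Classical in
/-- An estimator that almost surely eventually agrees with the matched difference is
consistent. -/
theorem tendstoInMeasure_of_eventually_eq_matchedDifference (hμ : MatchingModel μ s m)
    (hs : s ≠ ⊤) (hV : ∀ i, Measurable (V i))
    (hind : iIndepFun V P) (hlaw : ∀ i, P.map (V i) = μ) {M : ℕ} (hM : M ≠ 0)
    {f : ℕ → Ω → ℝ} (hf : ∀ n, Measurable (f n))
    (heq : ∀ᵐ ω ∂P, ∀ᶠ n : ℕ in atTop, f n ω = matchedDifference M s (fun i : Fin n => V i ω)) :
    TendstoInMeasure P f atTop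
      fun _ => (∫ a in {a | a.2.1 = s}, (a.1 - m a.2.2) ∂μ) / μ.real {a | a.2.1 = s} := by
  have := isProbabilityMeasure_of_map_eq hV hlaw
  -- The noise converges only in measure, everything else almost surely. The subsequence criterion
  -- reconciles the two.
  rw [exists_seq_tendstoInMeasure_atTop_iff fun n => (hf n).aestronglyMeasurable]
  intro ns hns
  have hnoise : TendstoInMeasure P (fun k => matchingNoise M s m V (ns k)) atTop fun _ => 0 :=
    (tendstoInMeasure_matchingNoise hμ hV hind hlaw M).comp hns.tendsto_atTop
  obtain ⟨ns', hns', hae⟩ := hnoise.exists_seq_tendsto_ae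
  refine ⟨ns', hns', ?_⟩
  have hp : 0 < μ.real {a | a.2.1 = s} :=
    ENNReal.toReal_pos hμ.treated_ne_zero (measure_ne_top _ _)
  filter_upwards [hae, heq, ae_tendsto_matchedDifference_add hμ hs hV hind hlaw hM,
    ae_tendsto_frequency hV hind hlaw (measurableSet_cohort s)] with ω h1 h2 h3 h4
  have hsub : Tendsto (fun k => ns (ns' k)) atTop atTop :=
    hns.tendsto_atTop.comp hns'.tendsto_atTop
  replace h4 : Tendsto (fun n : ℕ =>
      ((Finset.univ.filter fun i : Fin n => (V i ω).2.1 = s).card : ℝ) / n) atTop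
      (𝓝 (μ.real {a | a.2.1 = s})) := by
    convert h4
  have h5 := (h3.comp hsub).sub (((h4.comp hsub).inv₀ hp.ne').mul (h1.div_const (M : ℝ)))
  rw [zero_div, mul_zero, sub_zero] at h5
  refine h5.congr' ?_
  filter_upwards [hsub.eventually h2] with k hk
  simp only [hk, Function.comp_apply]
  ring

end Consistency

/-! ### Conditioning on cohorts and covariates -/

theorem integral_mul_comp_eq_integral_mul_condExp {Ω E : Type*} [mΩ : MeasurableSpace Ω]
    [MeasurableSpace E] {ν : Measure Ω} [IsFiniteMeasure ν] {X : Ω → E} (hX : Measurable X)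
    {ψ : E → ℝ} (hψ : Measurable ψ) {B : ℝ} (hB : ∀ x, |ψ x| ≤ B) {h : Ω → ℝ}
    (hh : Integrable h ν) :
    ∫ ω, ψ (X ω) * h ω ∂ν =
      ∫ ω, ψ (X ω) * (ν[h | MeasurableSpace.comap X inferInstance]) ω ∂ν := by
  have hm : MeasurableSpace.comap X inferInstance ≤ mΩ := hX.comap_le
  have hint : Integrable ((fun ω => ψ (X ω)) * h) ν :=
    hh.bdd_mul (c := B) (hψ.comp hX).aestronglyMeasurable (Eventually.of_forall fun ω => hB _)
  have hsm : StronglyMeasurable[MeasurableSpace.comap X inferInstance] fun ω => ψ (X ω) :=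
    (hψ.comp (comap_measurable X)).stronglyMeasurable
  calc ∫ ω, ψ (X ω) * h ω ∂ν
      = ∫ ω, (ν[(fun ω => ψ (X ω)) * h | MeasurableSpace.comap X inferInstance]) ω ∂ν :=
        (integral_condExp hm).symm
    _ = _ := integral_congr_ae (condExp_mul_of_stronglyMeasurable_left hsm hint hh)

namespace Panel

variable {T q : ℕ} {Ω : Type*} [mΩ : MeasurableSpace Ω] {D : Panel T q Ω} {P : Measure Ω}
  [IsProbabilityMeasure P] {i : ℕ}

theorem measurableSet_tstar (D : Panel T q Ω) (i : ℕ) (c : Cohort T) :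
    MeasurableSet (D.tstar i ⁻¹' {c}) :=
  D.measurable_tstar i (measurableSet_singleton c)

/-- The realized path is random but takes finitely many values, so measurability can be checked
cohort by cohort. -/
theorem measurable_Yobs (D : Panel T q Ω) (i : ℕ) (t : Fin T) : Measurable (D.Yobs i t) := by
  have h : Measurable fun p : Cohort T × Ω => D.Y i (cohortPath p.1) t p.2 :=
    measurable_from_prod_countable_right fun c => D.measurable_Y i (cohortPath c) t
  exact h.comp ((D.measurable_tstar i).prodMk measurable_id)

theorem isProbabilityMeasure_condCohort {c : Cohort T} (hc : c ∈ D.cohorts P i) :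
    IsProbabilityMeasure (D.condCohort P i c) :=
  cond_isProbabilityMeasure (ne_of_gt hc)

omit [IsProbabilityMeasure P] in
theorem ae_condCohort_tstar_eq (c : Cohort T) :
    ∀ᵐ ω ∂(D.condCohort P i c), D.tstar i ω = c := by
  filter_upwards [ae_cond_mem (μ := P) (measurableSet_tstar D i c)] with ω hω
  exact hω

omit [IsProbabilityMeasure P] in
theorem condCohort_absolutelyContinuous (c : Cohort T) : D.condCohort P i c ≪ P :=
  cond_absolutelyContinuous

theorem condCohort_eq_zero_iff {c : Cohort T} (B : Set Ω) :
    D.condCohort P i c B = 0 ↔ P (D.tstar i ⁻¹' {c} ∩ B) = 0 := by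
  rw [condCohort, cond_apply (measurableSet_tstar D i c)]
  simp [measure_ne_top]

theorem measure_eq_zero_of_forall_condCohort {B : Set Ω}
    (h : ∀ c ∈ D.cohorts P i, D.condCohort P i c B = 0) : P B = 0 := by
  have hB : B ⊆ ⋃ c : Cohort T, D.tstar i ⁻¹' {c} ∩ B := fun ω hω =>
    Set.mem_iUnion.2 ⟨D.tstar i ω, rfl, hω⟩
  refine measure_mono_null hB (measure_iUnion_null fun c => ?_)
  by_cases hc : c ∈ D.cohorts P i
  · exact (condCohort_eq_zero_iff B).1 (h c hc)
  · have : P (D.tstar i ⁻¹' {c}) = 0 := by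
      simpa [cohorts] using hc
    exact measure_mono_null Set.inter_subset_left this

theorem integrable_condCohort_iff {c : Cohort T} (hc : c ∈ D.cohorts P i) {f : Ω → ℝ} :
    Integrable f (D.condCohort P i c) ↔ IntegrableOn f (D.tstar i ⁻¹' {c}) P := by
  rw [condCohort, ProbabilityTheory.cond, IntegrableOn]
  exact integrable_smul_measure (ENNReal.inv_ne_zero.2 (measure_ne_top _ _))
    (ENNReal.inv_ne_top.2 (ne_of_gt hc))

theorem integrable_of_forall_condCohort {f : Ω → ℝ}
    (h : ∀ c ∈ D.cohorts P i, Integrable f (D.condCohort P i c)) : Integrable f P := by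
  have huniv : (⋃ c : Cohort T, D.tstar i ⁻¹' {c}) = Set.univ := by
    ext ω
    simp
  rw [← integrableOn_univ, ← huniv]
  refine integrableOn_finite_iUnion.2 fun c => ?_
  by_cases hc : c ∈ D.cohorts P i
  · exact (integrable_condCohort_iff hc).1 (h c hc)
  · have : P (D.tstar i ⁻¹' {c}) = 0 := by
      simpa [cohorts] using hc
    rw [IntegrableOn, Measure.restrict_eq_zero.2 this]
    exact integrable_zero_measure

omit [IsProbabilityMeasure P] in
theorem integral_condCohort (c : Cohort T) (f : Ω → ℝ) :
    ∫ ω, f ω ∂(D.condCohort P i c) =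
      (P.real (D.tstar i ⁻¹' {c}))⁻¹ * ∫ ω in D.tstar i ⁻¹' {c}, f ω ∂P := by
  rw [condCohort, ProbabilityTheory.cond, integral_smul_measure, ENNReal.toReal_inv]
  rfl

theorem setIntegral_tstar {c : Cohort T} (hc : c ∈ D.cohorts P i) (f : Ω → ℝ) :
    ∫ ω in D.tstar i ⁻¹' {c}, f ω ∂P =
      P.real (D.tstar i ⁻¹' {c}) * ∫ ω, f ω ∂(D.condCohort P i c) := by
  have : P.real (D.tstar i ⁻¹' {c}) ≠ 0 :=
    (ENNReal.toReal_pos (ne_of_gt hc) (measure_ne_top _ _)).ne'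
  rw [integral_condCohort, mul_inv_cancel_left₀ this]

omit [IsProbabilityMeasure P] in
theorem Yobs_ae_eq (c : Cohort T) (t : Fin T) :
    D.Yobs i t =ᵐ[D.condCohort P i c] D.Y i (cohortPath c) t := by
  filter_upwards [ae_condCohort_tstar_eq c] with ω hω
  rw [Yobs, hω]

omit [IsProbabilityMeasure P] in
theorem covariateLaw_apply (c : Cohort T) {N : Set (EuclideanSpace ℝ (Fin q))}
    (hN : MeasurableSet N) : D.covariateLaw P i c N = D.condCohort P i c (D.X i ⁻¹' N) :=
  Measure.map_apply (D.measurable_X i) hN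

/-! ### Covariates -/

omit [IsProbabilityMeasure P] in
theorem top_mem_cohorts (hO : D.Overlap P) : (⊤ : Cohort T) ∈ D.cohorts P i := (hO i).1

theorem map_X_absolutelyContinuous_volume (hR : D.RegularDensities P) :
    P.map (D.X i) ≪ volume := by
  obtain ⟨f, hf, -⟩ := hR i
  refine Measure.AbsolutelyContinuous.mk fun N hN h0 => ?_
  rw [Measure.map_apply (D.measurable_X i) hN]
  refine measure_eq_zero_of_forall_condCohort (D := D) (i := i) fun c hc => ?_
  rw [← covariateLaw_apply c hN, (hf c hc).2.2.1]
  exact withDensity_absolutelyContinuous _ _ h0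

/-- On the support of X the density of the never-treated is at least b > 0, so a set they do not
charge is Lebesgue-null there, hence null for X. This carries almost sure statements from the
never-treated to everyone. -/
theorem map_X_absolutelyContinuous_covariateLaw (hR : D.RegularDensities P)
    (hO : D.Overlap P) : P.map (D.X i) ≪ D.covariateLaw P i ⊤ := by
  obtain ⟨f, hf, b, hb, hbf⟩ := hR i
  obtain ⟨hfm, -, hlaw, -⟩ := hf ⊤ (top_mem_cohorts hO)
  refine Measure.AbsolutelyContinuous.mk fun N hN h0 => ?_
  set S := (P.map (D.X i)).support with hS
  have hSm : MeasurableSet S := Measure.isClosed_support.measurableSet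
  have h1 : volume (N ∩ S) = 0 := by
    have h2 : D.covariateLaw P i ⊤ (N ∩ S) = 0 := measure_mono_null Set.inter_subset_left h0
    rw [hlaw, withDensity_apply _ (hN.inter hSm)] at h2
    have h3 : ENNReal.ofReal b * volume (N ∩ S) ≤ ∫⁻ x in N ∩ S, ENNReal.ofReal (f ⊤ x) := by
      rw [← setLIntegral_const]
      exact setLIntegral_mono (by fun_prop) fun x hx => ENNReal.ofReal_le_ofReal (hbf x hx.2)
    rw [h2, nonpos_iff_eq_zero, mul_eq_zero] at h3
    exact h3.resolve_left (ENNReal.ofReal_pos.2 hb).ne'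
  have h4 : P.map (D.X i) (N ∩ S) = 0 := map_X_absolutelyContinuous_volume hR h1
  have h5 : P.map (D.X i) Sᶜ = 0 := mem_ae_iff.1 Measure.support_mem_ae
  refine measure_mono_null (fun x hx => ?_) (measure_union_null h4 h5)
  by_cases hxS : x ∈ S
  · exact Or.inl ⟨hx, hxS⟩
  · exact Or.inr hxS

theorem measure_preimage_X_eq_zero (hR : D.RegularDensities P) (hO : D.Overlap P)
    {N : Set (EuclideanSpace ℝ (Fin q))} (hN : MeasurableSet N)
    (h : D.condCohort P i ⊤ (D.X i ⁻¹' N) = 0) : P (D.X i ⁻¹' N) = 0 := by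
  rw [← Measure.map_apply (D.measurable_X i) hN]
  refine map_X_absolutelyContinuous_covariateLaw hR hO ?_
  rw [covariateLaw_apply _ hN, h]

/-- Almost every unit lies where controls are found arbitrarily close by. -/
theorem ae_X_mem_support (hR : D.RegularDensities P) (hO : D.Overlap P) :
    ∀ᵐ ω ∂P, D.X i ω ∈ (D.covariateLaw P i ⊤).support := by
  have hSm : MeasurableSet (D.covariateLaw P i ⊤).support := Measure.isClosed_support.measurableSet
  refine measure_preimage_X_eq_zero (i := i) hR hO hSm.compl ?_
  rw [← covariateLaw_apply _ hSm.compl]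
  exact mem_ae_iff.1 Measure.support_mem_ae

/-- Spheres, including points, are Lebesgue-null as soon as q ≥ 1; for q = 0 the only point has full
mass. -/
theorem measure_dist_X_eq_zero (hq : 1 ≤ q) (hR : D.RegularDensities P)
    (x : EuclideanSpace ℝ (Fin q)) (r : ℝ) : P {ω | dist (D.X i ω) x = r} = 0 := by
  have : Nonempty (Fin q) := ⟨⟨0, hq⟩⟩
  have h := map_X_absolutelyContinuous_volume (i := i) hR
    (Measure.addHaar_sphere (volume : Measure (EuclideanSpace ℝ (Fin q))) x r)
  rwa [Measure.map_apply (D.measurable_X i) Metric.isClosed_sphere.measurableSet] at h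

theorem measure_tstar_top_ball_ne_zero {x : EuclideanSpace ℝ (Fin q)}
    (hx : x ∈ (D.covariateLaw P i ⊤).support) {ε : ℝ} (hε : 0 < ε) :
    P {ω | D.tstar i ω = ⊤ ∧ D.X i ω ∈ Metric.ball x ε} ≠ 0 := by
  have h := (Measure.mem_support_iff_forall x).1 hx _ (Metric.ball_mem_nhds x hε)
  rw [covariateLaw_apply _ measurableSet_ball] at h
  exact fun h0 => h.ne' ((condCohort_eq_zero_iff _).2 h0)

/-! ### The regression function of the never-treated -/

/-- The combination `∑_t a_t Y_{it}(0)` of untreated potential outcomes. -/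
def untreatedContrast (D : Panel T q Ω) (a : Fin T → ℝ) (i : ℕ) (ω : Ω) : ℝ :=
  ∑ t, a t * D.Y0 i t ω

theorem integrable_Y0 (hL : D.LipschitzMean P) (t : Fin T) : Integrable (D.Y0 i t) P :=
  integrable_of_forall_condCohort fun c hc => (hL i c hc t (cohortPath ⊤)).1

theorem integrable_Yobs (hL : D.LipschitzMean P) (t : Fin T) : Integrable (D.Yobs i t) P :=
  integrable_of_forall_condCohort fun c hc =>
    ((hL i c hc t (cohortPath c)).1).congr (Yobs_ae_eq c t).symm

theorem integrable_untreatedContrast (hL : D.LipschitzMean P) (a : Fin T → ℝ) :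
    Integrable (D.untreatedContrast a i) P :=
  integrable_finsetSum _ fun t _ => (integrable_Y0 hL t).const_mul (a t)

theorem integrable_condCohort_of_integrable {c : Cohort T} (hc : c ∈ D.cohorts P i) {f : Ω → ℝ}
    (hf : Integrable f P) : Integrable f (D.condCohort P i c) :=
  (integrable_condCohort_iff hc).2 hf.integrableOn

/-- The period-wise means are Lipschitz on the support only; they are extended to the whole space
before being combined, which changes nothing almost surely. -/
theorem exists_lipschitz_condExp (hO : D.Overlap P) (hL : D.LipschitzMean P) (a : Fin T → ℝ) :
    ∃ (m : EuclideanSpace ℝ (Fin q) → ℝ) (K : NNReal), LipschitzWith K m ∧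
      (D.condCohort P i ⊤)[D.untreatedContrast a i | D.sigmaX i]
        =ᵐ[D.condCohort P i ⊤] fun ω => m (D.X i ω) := by
  have htop := top_mem_cohorts (i := i) hO
  have hX : ∀ᵐ ω ∂(D.condCohort P i ⊤), D.X i ω ∈ (D.covariateLaw P i ⊤).support :=
    ae_of_ae_map (D.measurable_X i).aemeasurable Measure.support_mem_ae
  have h : ∀ t, ∃ (m : EuclideanSpace ℝ (Fin q) → ℝ) (K : NNReal), LipschitzWith K m ∧
      (D.condCohort P i ⊤)[D.Y0 i t | D.sigmaX i]
        =ᵐ[D.condCohort P i ⊤] fun ω => m (D.X i ω) := by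
    intro t
    obtain ⟨-, m, K, hm, hcond⟩ := hL i ⊤ htop t (cohortPath ⊤)
    obtain ⟨g, hg, hgm⟩ := hm.extend_real
    refine ⟨g, K, hg, ?_⟩
    filter_upwards [hcond, hX] with ω h1 h2
    rw [← hgm h2]
    exact h1
  choose m K hm hcond using h
  refine ⟨fun x => ∑ t, a t * m t x, ∑ t, ‖a t‖₊ * K t,
    LipschitzWith.of_dist_le_mul fun x y => ?_, ?_⟩
  · rw [Real.dist_eq, ← Finset.sum_sub_distrib]
    push_cast
    rw [Finset.sum_mul]
    refine (Finset.abs_sum_le_sum_abs _ _).trans (Finset.sum_le_sum fun t _ => ?_)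
    rw [← mul_sub, abs_mul, mul_assoc]
    exact mul_le_mul_of_nonneg_left ((hm t).dist_le_mul x y) (abs_nonneg _)
  · have e : D.untreatedContrast a i = ∑ t, a t • D.Y0 i t := by
      funext ω
      simp [untreatedContrast]
    rw [e]
    refine (condExp_finsetSum (fun t _ => ((integrable_condCohort_of_integrable htop
      (integrable_Y0 hL t)).smul (a t))) _).trans ?_
    have h1 : ∀ᵐ ω ∂(D.condCohort P i ⊤), ∀ t,
        ((D.condCohort P i ⊤)[a t • D.Y0 i t | D.sigmaX i]) ω = a t * m t (D.X i ω) := by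
      refine ae_all_iff.2 fun t => ?_
      filter_upwards [condExp_smul (μ := D.condCohort P i ⊤) (a t) (D.Y0 i t) (D.sigmaX i),
        hcond t] with ω h1 h2
      rw [h1, Pi.smul_apply, h2, smul_eq_mul]
    filter_upwards [h1] with ω hω
    simp only [Finset.sum_apply, hω]

theorem exists_abs_le_of_lipschitz (hR : D.RegularDensities P) (hO : D.Overlap P)
    {m : EuclideanSpace ℝ (Fin q) → ℝ} {K : NNReal} (hm : LipschitzWith K m) :
    ∃ B, ∀ᵐ ω ∂P, |m (D.X i ω)| ≤ B := by
  obtain ⟨f, hf, -⟩ := hR i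
  have hcomp := (hf ⊤ (top_mem_cohorts hO)).2.2.2.2.2
  obtain ⟨B, hB⟩ := hcomp.exists_bound_of_continuousOn hm.continuous.continuousOn
  refine ⟨B, ?_⟩
  filter_upwards [ae_X_mem_support (i := i) hR hO] with ω hω
  exact hB _ hω

theorem integrable_comp_X (hR : D.RegularDensities P) (hO : D.Overlap P)
    {m : EuclideanSpace ℝ (Fin q) → ℝ} {K : NNReal} (hm : LipschitzWith K m) :
    Integrable (fun ω => m (D.X i ω)) P := by
  obtain ⟨B, hB⟩ := exists_abs_le_of_lipschitz (i := i) hR hO hm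
  exact Integrable.of_bound (hm.continuous.measurable.comp (D.measurable_X i)).aestronglyMeasurable
    B hB

/-! ### Identification -/

/-- Telescoping: a long difference from the first period is a sum of one-period differences. -/
theorem condExp_Y0_sub_eq (hL : D.LipschitzMean P) (hC : D.ConditionalParallelTrends P)
    (t₀ : Fin T) (ht₀ : t₀.val = 0) (t : Fin T) :
    P[D.Y0 i t - D.Y0 i t₀ | D.sigmaTX i] =ᵐ[P] P[D.Y0 i t - D.Y0 i t₀ | D.sigmaX i] := by
  obtain ⟨k, hk⟩ := t
  induction k with
  | zero =>
    have : (⟨0, hk⟩ : Fin T) = t₀ := Fin.ext ht₀.symm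
    rw [this, sub_self, condExp_zero, condExp_zero]
  | succ k ih =>
    have hk' : k < T := by omega
    have e : D.Y0 i ⟨k + 1, hk⟩ - D.Y0 i t₀ =
        (D.Y0 i ⟨k + 1, hk⟩ - D.Y0 i ⟨k, hk'⟩) + (D.Y0 i ⟨k, hk'⟩ - D.Y0 i t₀) := by
      rw [sub_add_sub_cancel]
    have i1 := (integrable_Y0 (i := i) hL ⟨k + 1, hk⟩).sub (integrable_Y0 (i := i) hL ⟨k, hk'⟩)
    have i2 := (integrable_Y0 (i := i) hL ⟨k, hk'⟩).sub (integrable_Y0 (i := i) hL t₀)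
    rw [e]
    refine (condExp_add i1 i2 _).trans (EventuallyEq.trans ?_ (condExp_add i1 i2 _).symm)
    exact (hC i ⟨k + 1, hk⟩ ⟨k, hk'⟩ rfl).add (ih hk')

/-- As the coefficients sum to zero, the contrast is a combination of differences from the first
period. -/
theorem condExp_untreatedContrast_eq (hL : D.LipschitzMean P)
    (hC : D.ConditionalParallelTrends P) {a : Fin T → ℝ} (ha : ∑ t, a t = 0) (t₀ : Fin T)
    (ht₀ : t₀.val = 0) :
    P[D.untreatedContrast a i | D.sigmaTX i] =ᵐ[P] P[D.untreatedContrast a i | D.sigmaX i] := by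
  have e : D.untreatedContrast a i = ∑ t, a t • (D.Y0 i t - D.Y0 i t₀) := by
    funext ω
    simp only [untreatedContrast, Finset.sum_apply, Pi.smul_apply, Pi.sub_apply, smul_eq_mul,
      mul_sub, Finset.sum_sub_distrib, ← Finset.sum_mul, ha, zero_mul, sub_zero]
  have hint : ∀ t ∈ Finset.univ, Integrable (a t • (D.Y0 i t - D.Y0 i t₀)) P := fun t _ =>
    ((integrable_Y0 hL t).sub (integrable_Y0 hL t₀)).smul (a t)
  rw [e]
  refine (condExp_finsetSum hint _).trans (EventuallyEq.trans ?_ (condExp_finsetSum hint _).symm)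
  have h : ∀ᵐ ω ∂P, ∀ t, (P[a t • (D.Y0 i t - D.Y0 i t₀) | D.sigmaTX i]) ω =
      (P[a t • (D.Y0 i t - D.Y0 i t₀) | D.sigmaX i]) ω := by
    refine ae_all_iff.2 fun t => ?_
    filter_upwards [condExp_smul (μ := P) (a t) (D.Y0 i t - D.Y0 i t₀) (D.sigmaTX i),
      condExp_smul (μ := P) (a t) (D.Y0 i t - D.Y0 i t₀) (D.sigmaX i),
      condExp_Y0_sub_eq (i := i) hL hC t₀ ht₀ t] with ω h1 h2 h3
    rw [h1, h2, Pi.smul_apply, Pi.smul_apply, h3]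
  filter_upwards [h] with ω hω
  simp only [Finset.sum_apply, hω]

theorem sigmaTX_le (D : Panel T q Ω) (i : ℕ) : D.sigmaTX i ≤ mΩ :=
  ((D.measurable_tstar i).prodMk (D.measurable_X i)).comap_le

theorem sigmaX_le (D : Panel T q Ω) (i : ℕ) : D.sigmaX i ≤ mΩ := (D.measurable_X i).comap_le

/-- The event belongs to σ(t*, X), and the conditional expectation given (t*, X) is the one given X
alone. -/
theorem setIntegral_untreatedContrast (hL : D.LipschitzMean P)
    (hC : D.ConditionalParallelTrends P) {a : Fin T → ℝ} (ha : ∑ t, a t = 0) (t₀ : Fin T)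
    (ht₀ : t₀.val = 0) (c : Cohort T) {N : Set (EuclideanSpace ℝ (Fin q))}
    (hN : MeasurableSet N) :
    ∫ ω in D.tstar i ⁻¹' {c} ∩ D.X i ⁻¹' N, (P[D.untreatedContrast a i | D.sigmaX i]) ω ∂P =
      ∫ ω in D.tstar i ⁻¹' {c} ∩ D.X i ⁻¹' N, D.untreatedContrast a i ω ∂P := by
  have hB : MeasurableSet[D.sigmaTX i] (D.tstar i ⁻¹' {c} ∩ D.X i ⁻¹' N) :=
    ⟨{c} ×ˢ N, (measurableSet_singleton c).prod hN, rfl⟩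
  rw [← setIntegral_condExp (sigmaTX_le D i) (integrable_untreatedContrast hL a) hB]
  refine setIntegral_congr_ae (sigmaTX_le D i _ hB) ?_
  filter_upwards [condExp_untreatedContrast_eq (i := i) hL hC ha t₀ ht₀] with ω hω _
  exact hω.symm

/-- By conditional parallel trends, the regression function of the never-treated is the regression
function of the untreated contrast in the whole population. -/
theorem condExp_untreatedContrast_ae_eq (hR : D.RegularDensities P) (hO : D.Overlap P)
    (hL : D.LipschitzMean P) (hC : D.ConditionalParallelTrends P) {a : Fin T → ℝ}
    (ha : ∑ t, a t = 0) (t₀ : Fin T) (ht₀ : t₀.val = 0)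
    {m : EuclideanSpace ℝ (Fin q) → ℝ} (hm : Measurable m)
    (hcond : (D.condCohort P i ⊤)[D.untreatedContrast a i | D.sigmaX i]
        =ᵐ[D.condCohort P i ⊤] fun ω => m (D.X i ω)) :
    P[D.untreatedContrast a i | D.sigmaX i] =ᵐ[P] fun ω => m (D.X i ω) := by
  have htop := top_mem_cohorts (i := i) hO
  have := isProbabilityMeasure_condCohort htop
  have hsm : StronglyMeasurable[D.sigmaX i] (P[D.untreatedContrast a i | D.sigmaX i]) :=
    stronglyMeasurable_condExp
  have h1 : P[D.untreatedContrast a i | D.sigmaX i] =ᵐ[D.condCohort P i ⊤]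
      (D.condCohort P i ⊤)[D.untreatedContrast a i | D.sigmaX i] := by
    refine ae_eq_condExp_of_forall_setIntegral_eq (sigmaX_le D i)
      (integrable_condCohort_of_integrable htop (integrable_untreatedContrast hL a))
      (fun B _ _ => (integrable_condCohort_of_integrable htop integrable_condExp).integrableOn)
      ?_ hsm.aestronglyMeasurable
    rintro B ⟨N, hN, rfl⟩ -
    have hXN : MeasurableSet (D.X i ⁻¹' N) := D.measurable_X i hN
    rw [← integral_indicator hXN, ← integral_indicator hXN, integral_condCohort,
      integral_condCohort, setIntegral_indicator hXN, setIntegral_indicator hXN,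
      setIntegral_untreatedContrast hL hC ha t₀ ht₀ ⊤ hN]
  have h2 := h1.trans hcond
  have hmX : Measurable[D.sigmaX i] fun ω => m (D.X i ω) := hm.comp (comap_measurable _)
  have hne : MeasurableSet[D.sigmaX i]
      {ω | (P[D.untreatedContrast a i | D.sigmaX i]) ω ≠ m (D.X i ω)} :=
    (measurableSet_eq_fun hsm.measurable hmX).compl
  -- Both sides are functions of X, so the exceptional set is a preimage under X; it is null for the
  -- never-treated and therefore null under `P`.
  obtain ⟨N, hN, hNeq⟩ := hne
  rw [EventuallyEq, ae_iff] at h2 ⊢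
  change _ = {ω | ¬ _ = _} at hNeq
  rw [← hNeq] at h2 ⊢
  exact measure_preimage_X_eq_zero hR hO hN h2

/-- The regression function of the never-treated, averaged over the covariates of cohort `c`,
recovers the mean of its untreated contrast. -/
theorem integral_untreatedContrast (hR : D.RegularDensities P) (hO : D.Overlap P)
    (hL : D.LipschitzMean P) (hC : D.ConditionalParallelTrends P) {a : Fin T → ℝ}
    (ha : ∑ t, a t = 0) (t₀ : Fin T) (ht₀ : t₀.val = 0)
    {m : EuclideanSpace ℝ (Fin q) → ℝ} (hm : Measurable m)
    (hcond : (D.condCohort P i ⊤)[D.untreatedContrast a i | D.sigmaX i]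
        =ᵐ[D.condCohort P i ⊤] fun ω => m (D.X i ω)) (c : Cohort T) :
    ∫ ω, m (D.X i ω) ∂(D.condCohort P i c) =
      ∫ ω, D.untreatedContrast a i ω ∂(D.condCohort P i c) := by
  have h := setIntegral_untreatedContrast (i := i) hL hC ha t₀ ht₀ c MeasurableSet.univ
  rw [Set.preimage_univ, Set.inter_univ] at h
  rw [integral_condCohort c (D.untreatedContrast a i), ← h, ← integral_condCohort]
  refine integral_congr_ae ?_
  exact EventuallyEq.symm ((condCohort_absolutelyContinuous c).ae_le
    (condExp_untreatedContrast_ae_eq hR hO hL hC ha t₀ ht₀ hm hcond))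

omit [IsProbabilityMeasure P] in
-- Up to period `t < s`, the path of cohort `s` is the path of zeros.
theorem att_eq_zero_of_lt (hNA : D.NoAnticipation P) {s t : Fin T} (h : t < s) :
    D.att P i s t = 0 := by
  rw [att]
  refine integral_eq_zero_of_ae ?_
  have hpath : D.Y i (cohortPath (s : Cohort T)) t =ᵐ[D.condCohort P i s] D.Y0 i t := by
    refine (condCohort_absolutelyContinuous _).ae_le (hNA i t _ _ fun u hu => ?_)
    simp [cohortPath, hu.trans_lt h]
  filter_upwards [hpath, Yobs_ae_eq (D := D) (P := P) (i := i) (s : Cohort T) t] with ω h1 h2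
  rw [Yobs] at h2
  rw [effect, h2, h1, sub_self]
  rfl

theorem integral_contrast_sub (hR : D.RegularDensities P) (hO : D.Overlap P)
    (hL : D.LipschitzMean P) (hC : D.ConditionalParallelTrends P) {a : Fin T → ℝ}
    (ha : ∑ t, a t = 0)
    {m : EuclideanSpace ℝ (Fin q) → ℝ} {K : NNReal} (hm : LipschitzWith K m)
    (hcond : (D.condCohort P i ⊤)[D.untreatedContrast a i | D.sigmaX i]
        =ᵐ[D.condCohort P i ⊤] fun ω => m (D.X i ω)) {s : Fin T}
    (hs : (s : Cohort T) ∈ D.cohorts P i) :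
    ∫ ω, (∑ t, a t * D.Yobs i t ω - m (D.X i ω)) ∂(D.condCohort P i s) =
      ∑ t, a t * D.att P i s t := by
  have i1 : ∀ t, Integrable (D.Yobs i t) (D.condCohort P i s) := fun t =>
    integrable_condCohort_of_integrable hs (integrable_Yobs hL t)
  have i0 : ∀ t, Integrable (D.Y0 i t) (D.condCohort P i s) := fun t =>
    integrable_condCohort_of_integrable hs (integrable_Y0 hL t)
  have hT : 0 < T := s.pos
  rw [integral_sub (integrable_finsetSum _ fun t _ => (i1 t).const_mul (a t))
    (integrable_condCohort_of_integrable hs (integrable_comp_X hR hO hm)),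
    integral_untreatedContrast hR hO hL hC ha ⟨0, hT⟩ rfl hm.continuous.measurable hcond,
    integral_finsetSum _ fun t _ => (i1 t).const_mul (a t)]
  unfold untreatedContrast
  rw [integral_finsetSum _ fun t _ => (i0 t).const_mul (a t), ← Finset.sum_sub_distrib]
  refine Finset.sum_congr rfl fun t _ => ?_
  rw [integral_const_mul, integral_const_mul, ← mul_sub, ← integral_sub (i1 t) (i0 t)]
  rfl

end Panel

namespace Panel

variable {T q : ℕ} {Ω : Type*} [mΩ : MeasurableSpace Ω] {D : Panel T q Ω} {P : Measure Ω}
  {i : ℕ}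

/-! ### The law of the outcome contrast, the cohort and the covariates -/

/-- The contrast `∑_t a_t Y_{it}` of observed outcomes with the cohort and the covariates. -/
def contrastObservation (D : Panel T q Ω) (a : Fin T → ℝ) (i : ℕ) :
    Ω → ℝ × Cohort T × EuclideanSpace ℝ (Fin q) :=
  fun ω => (∑ t, a t * D.Yobs i t ω, D.tstar i ω, D.X i ω)

theorem measurable_contrastObservation (D : Panel T q Ω) (a : Fin T → ℝ) (i : ℕ) :
    Measurable (D.contrastObservation a i) :=
  (Finset.measurable_sum _ fun t _ => (measurable_Yobs D i t).const_mul (a t)).prodMk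
    ((D.measurable_tstar i).prodMk (D.measurable_X i))

theorem measurable_contrast (a : Fin T → ℝ) :
    Measurable fun o : (Fin T → ℝ) × Cohort T × EuclideanSpace ℝ (Fin q) =>
      (∑ t, a t * o.1 t, o.2) := by
  fun_prop

theorem iIndepFun_contrastObservation (hS : D.RandomSampling P) (a : Fin T → ℝ) :
    iIndepFun (D.contrastObservation a) P :=
  hS.1.comp (fun _ => fun o : (Fin T → ℝ) × Cohort T × EuclideanSpace ℝ (Fin q) =>
      (∑ t, a t * o.1 t, o.2)) fun _ => measurable_contrast a

theorem map_contrastObservation_eq (hS : D.RandomSampling P) (a : Fin T → ℝ) (j : ℕ) :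
    P.map (D.contrastObservation a j) = P.map (D.contrastObservation a i) :=
  ((hS.2 j i).comp (measurable_contrast a)).map_eq

variable [IsProbabilityMeasure P]

/-- On the never-treated the observed outcomes are the untreated ones. Elsewhere the residual is 0,
and `k ≠ 0` excludes 0 ^ 0 = 1. -/
theorem integral_mul_controlResidual_pow (hO : D.Overlap P) (a : Fin T → ℝ)
    {m : EuclideanSpace ℝ (Fin q) → ℝ} (hm : Measurable m)
    {φ : Cohort T × EuclideanSpace ℝ (Fin q) → ℝ} (hφ : Measurable φ) {k : ℕ} (hk : k ≠ 0) :
    ∫ o, φ o.2 * controlResidual m o ^ k ∂(P.map (D.contrastObservation a i)) =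
      P.real (D.tstar i ⁻¹' {⊤}) * ∫ ω, φ (⊤, D.X i ω) *
        (D.untreatedContrast a i ω - m (D.X i ω)) ^ k ∂(D.condCohort P i ⊤) := by
  rw [integral_map (f := fun o => φ o.2 * controlResidual m o ^ k)
    (measurable_contrastObservation D a i).aemeasurable ((hφ.comp measurable_snd).mul
      ((measurable_controlResidual hm).pow_const k)).aestronglyMeasurable,
    ← setIntegral_tstar (top_mem_cohorts hO), ← integral_indicator (measurableSet_tstar D i ⊤)]
  refine integral_congr_ae (Eventually.of_forall fun ω => ?_)
  by_cases hω : D.tstar i ω = ⊤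
  · have : ω ∈ D.tstar i ⁻¹' {⊤} := hω
    simp only [Set.indicator_of_mem this, contrastObservation, controlResidual, hω, if_true, Yobs,
      untreatedContrast, Y0]
  · simp [contrastObservation, controlResidual, hω, hk]

/-- Cauchy–Schwarz, y² ≤ 1 + y⁴ and (p - b)² ≤ 2 p² + 2 b²: the square is controlled by the fourth
powers, whose conditional moments are bounded. -/
theorem sq_contrast_sub_le (a y : Fin T → ℝ) {b B : ℝ} (hb : |b| ≤ B) :
    (∑ t, a t * y t - b) ^ 2 ≤ 2 * (∑ t, a t ^ 2) * ∑ t, (1 + y t ^ 4) + 2 * B ^ 2 := by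
  have h1 : (∑ t, a t * y t) ^ 2 ≤ (∑ t, a t ^ 2) * ∑ t, (1 + y t ^ 4) := by
    refine (Finset.sum_mul_sq_le_sq_mul_sq _ _ _).trans ?_
    refine mul_le_mul_of_nonneg_left (Finset.sum_le_sum fun t _ => ?_)
      (Finset.sum_nonneg fun t _ => sq_nonneg _)
    nlinarith [sq_nonneg (y t ^ 2 - 1), sq_nonneg (y t)]
  have h2 : b ^ 2 ≤ B ^ 2 := sq_le_sq' (neg_le_of_abs_le hb) (le_of_abs_le hb)
  nlinarith [sq_nonneg (∑ t, a t * y t + b)]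

theorem exists_sq_residual_le (hR : D.Regularity P) (hO : D.Overlap P) (a : Fin T → ℝ)
    {m : EuclideanSpace ℝ (Fin q) → ℝ} {K : NNReal} (hm : LipschitzWith K m) :
    Integrable (fun ω => (D.untreatedContrast a i ω - m (D.X i ω)) ^ 2) (D.condCohort P i ⊤) ∧
    ∃ C, 0 ≤ C ∧ ∀ ψ : EuclideanSpace ℝ (Fin q) → ℝ, Measurable ψ → (∀ x, 0 ≤ ψ x) →
      (∃ B, ∀ x, |ψ x| ≤ B) →
      ∫ ω, ψ (D.X i ω) * (D.untreatedContrast a i ω - m (D.X i ω)) ^ 2 ∂(D.condCohort P i ⊤) ≤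
        C * ∫ ω, ψ (D.X i ω) ∂(D.condCohort P i ⊤) := by
  have htop := top_mem_cohorts (i := i) hO
  have := isProbabilityMeasure_condCohort htop
  obtain ⟨B, hB⟩ := exists_abs_le_of_lipschitz (i := i) hR.densities hO hm
  replace hB : ∀ᵐ ω ∂(D.condCohort P i ⊤), |m (D.X i ω)| ≤ B :=
    (condCohort_absolutelyContinuous ⊤).ae_le hB
  have hfour : ∀ t, Integrable (fun ω => D.Y0 i t ω ^ 4) (D.condCohort P i ⊤) := fun t =>
    (hR.fourthMoment i ⊤ htop t (cohortPath ⊤)).1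
  have hCt : ∀ t, ∃ C : ℝ, ∀ᵐ ω ∂(D.condCohort P i ⊤),
      ((D.condCohort P i ⊤)[fun ω' => D.Y0 i t ω' ^ 4 | D.sigmaX i]) ω ≤ C := fun t =>
    (hR.fourthMoment i ⊤ htop t (cohortPath ⊤)).2
  choose C hC using hCt
  set A : ℝ := ∑ t, a t ^ 2 with hA
  have hA0 : 0 ≤ A := Finset.sum_nonneg fun t _ => sq_nonneg _
  have hpt : ∀ᵐ ω ∂(D.condCohort P i ⊤),
      (D.untreatedContrast a i ω - m (D.X i ω)) ^ 2 ≤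
        2 * A * ∑ t, (1 + D.Y0 i t ω ^ 4) + 2 * B ^ 2 := by
    filter_upwards [hB] with ω hω
    exact sq_contrast_sub_le a (fun t => D.Y0 i t ω) hω
  have hmeas : Measurable fun ω => (D.untreatedContrast a i ω - m (D.X i ω)) ^ 2 :=
    ((Finset.measurable_sum _ fun t _ => (D.measurable_Y i (cohortPath ⊤) t).const_mul (a t)).sub
      (hm.continuous.measurable.comp (D.measurable_X i))).pow_const 2
  have hintQ : Integrable (fun ω => 2 * A * ∑ t, (1 + D.Y0 i t ω ^ 4) + 2 * B ^ 2)
      (D.condCohort P i ⊤) :=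
    ((integrable_finsetSum _ fun t _ => (integrable_const (1 : ℝ)).add (hfour t)).const_mul
      (2 * A)).add (integrable_const _)
  have hint : Integrable (fun ω => (D.untreatedContrast a i ω - m (D.X i ω)) ^ 2)
      (D.condCohort P i ⊤) := by
    refine hintQ.mono' hmeas.aestronglyMeasurable ?_
    filter_upwards [hpt] with ω hω
    rwa [Real.norm_eq_abs, abs_of_nonneg (sq_nonneg _)]
  -- The bounds `C t` come without a sign; the maximum with 0 makes the constant nonnegative.
  refine ⟨hint, max (2 * A * ∑ t, (1 + C t) + 2 * B ^ 2) 0, le_max_right _ _, ?_⟩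
  rintro ψ hψ hψ0 ⟨b, hb⟩
  have hψm : AEStronglyMeasurable (fun ω => ψ (D.X i ω)) (D.condCohort P i ⊤) :=
    (hψ.comp (D.measurable_X i)).aestronglyMeasurable
  have hbd : ∀ᵐ ω ∂(D.condCohort P i ⊤), ‖ψ (D.X i ω)‖ ≤ b := Eventually.of_forall fun ω => hb _
  have hψint : Integrable (fun ω => ψ (D.X i ω)) (D.condCohort P i ⊤) :=
    Integrable.of_bound hψm b hbd
  have hψ4 : ∀ t, Integrable (fun ω => ψ (D.X i ω) * D.Y0 i t ω ^ 4) (D.condCohort P i ⊤) :=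
    fun t => (hfour t).bdd_mul hψm hbd
  have hnn : 0 ≤ ∫ ω, ψ (D.X i ω) ∂(D.condCohort P i ⊤) := integral_nonneg fun ω => hψ0 _
  have hYt : ∀ t, ∫ ω, ψ (D.X i ω) * D.Y0 i t ω ^ 4 ∂(D.condCohort P i ⊤) ≤
      C t * ∫ ω, ψ (D.X i ω) ∂(D.condCohort P i ⊤) := by
    intro t
    rw [integral_mul_comp_eq_integral_mul_condExp (D.measurable_X i) hψ hb (hfour t),
      ← integral_const_mul]
    refine integral_mono_ae (integrable_condExp.bdd_mul hψm hbd) (hψint.const_mul _) ?_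
    filter_upwards [hC t] with ω hω
    rw [mul_comm (C t)]
    exact mul_le_mul_of_nonneg_left hω (hψ0 _)
  calc ∫ ω, ψ (D.X i ω) * (D.untreatedContrast a i ω - m (D.X i ω)) ^ 2 ∂(D.condCohort P i ⊤)
      ≤ ∫ ω, (2 * A * ∑ t, (ψ (D.X i ω) + ψ (D.X i ω) * D.Y0 i t ω ^ 4)
          + 2 * B ^ 2 * ψ (D.X i ω)) ∂(D.condCohort P i ⊤) := by
        refine integral_mono_ae (hint.bdd_mul hψm hbd)
          (((integrable_finsetSum _ fun t _ => hψint.add (hψ4 t)).const_mul _).add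
            (hψint.const_mul _)) ?_
        filter_upwards [hpt] with ω hω
        refine (mul_le_mul_of_nonneg_left hω (hψ0 (D.X i ω))).trans (le_of_eq ?_)
        have : ∑ t, (ψ (D.X i ω) + ψ (D.X i ω) * D.Y0 i t ω ^ 4) =
            ψ (D.X i ω) * ∑ t, (1 + D.Y0 i t ω ^ 4) := by
          rw [Finset.mul_sum]
          exact Finset.sum_congr rfl fun t _ => by ring
        rw [this]
        ring
    _ = 2 * A * ∑ t, (∫ ω, ψ (D.X i ω) ∂(D.condCohort P i ⊤) +
          ∫ ω, ψ (D.X i ω) * D.Y0 i t ω ^ 4 ∂(D.condCohort P i ⊤))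
          + 2 * B ^ 2 * ∫ ω, ψ (D.X i ω) ∂(D.condCohort P i ⊤) := by
        have hsum : ∀ t, Integrable (fun ω => ψ (D.X i ω) + ψ (D.X i ω) * D.Y0 i t ω ^ 4)
            (D.condCohort P i ⊤) := fun t => hψint.add (hψ4 t)
        rw [integral_add ((integrable_finsetSum _ fun t _ => hsum t).const_mul _)
            (hψint.const_mul _), integral_const_mul, integral_const_mul,
          integral_finsetSum _ fun t _ => hsum t]
        simp only [fun t => integral_add hψint (hψ4 t)]
    _ ≤ 2 * A * ∑ t, (∫ ω, ψ (D.X i ω) ∂(D.condCohort P i ⊤) +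
          C t * ∫ ω, ψ (D.X i ω) ∂(D.condCohort P i ⊤))
          + 2 * B ^ 2 * ∫ ω, ψ (D.X i ω) ∂(D.condCohort P i ⊤) := by
        gcongr with t _
        exact hYt t
    _ = (2 * A * ∑ t, (1 + C t) + 2 * B ^ 2) * ∫ ω, ψ (D.X i ω) ∂(D.condCohort P i ⊤) := by
        rw [add_mul, mul_assoc (2 * A), Finset.sum_mul]
        congr 2
        exact Finset.sum_congr rfl fun t _ => by ring
    _ ≤ _ := mul_le_mul_of_nonneg_right (le_max_left _ _) hnn

/-- The residual is centred because m is the regression function of the never-treated; parallel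
trends enter only when the limit is identified. -/
theorem matchingModel (hq : 1 ≤ q) (hO : D.Overlap P) (hR : D.Regularity P) (a : Fin T → ℝ)
    {s : Cohort T} (hs : s ∈ D.cohorts P i) {m : EuclideanSpace ℝ (Fin q) → ℝ} {K : NNReal}
    (hm : LipschitzWith K m)
    (hcond : (D.condCohort P i ⊤)[D.untreatedContrast a i | D.sigmaX i]
        =ᵐ[D.condCohort P i ⊤] fun ω => m (D.X i ω)) :
    MatchingModel (P.map (D.contrastObservation a i)) s m := by
  have htop := top_mem_cohorts (i := i) hO
  have := isProbabilityMeasure_condCohort htop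
  have hV := measurable_contrastObservation D a i
  have hmm : Measurable m := hm.continuous.measurable
  have hmX := integrable_comp_X (i := i) hR.densities hO hm
  have hcr : Measurable (controlResidual (T := T) m) := measurable_controlResidual hmm
  obtain ⟨hsq, C, hC0, hC⟩ := exists_sq_residual_le (i := i) hR hO a hm
  have hRint : Integrable (fun ω => D.untreatedContrast a i ω - m (D.X i ω))
      (D.condCohort P i ⊤) :=
    integrable_condCohort_of_integrable htop ((integrable_untreatedContrast hR.mean a).sub hmX)
  have hS : MeasurableSet (D.covariateLaw P i ⊤).support := Measure.isClosed_support.measurableSet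
  refine ⟨?_, ?_, ⟨K, hm⟩, ?_, ?_, ?_, ?_, ?_⟩
  · rw [integrable_map_measure (by fun_prop) hV.aemeasurable]
    exact Integrable.sub (f := fun ω => ∑ t, a t * D.Yobs i t ω)
      (integrable_finsetSum _ fun t _ => (integrable_Yobs hR.mean t).const_mul (a t)) hmX
  · rw [Measure.map_apply hV (measurableSet_cohort s)]
    exact ne_of_gt hs
  · obtain ⟨f, hf, -⟩ := hR.densities i
    refine ⟨_, (hf ⊤ htop).2.2.2.2.2, ?_, fun x hx ε hε => ?_⟩
    · rw [ae_map_iff hV.aemeasurable (measurableSet_covariate hS)]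
      exact ae_X_mem_support hR.densities hO
    · rw [Measure.map_apply (s := {a | a.2.1 = ⊤ ∧ a.2.2 ∈ Metric.ball x ε}) hV
        ((measurableSet_cohort ⊤).inter (measurableSet_covariate measurableSet_ball))]
      exact measure_tstar_top_ball_ne_zero hx hε
  · intro x r
    rw [Measure.map_apply (s := {a | dist a.2.2 x = r}) hV
      (measurableSet_covariate (Metric.isClosed_sphere (x := x) (ε := r)).measurableSet)]
    exact measure_dist_X_eq_zero hq hR.densities x r
  · rw [integrable_map_measure (hcr.pow_const 2).aestronglyMeasurable hV.aemeasurable]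
    refine ((integrable_indicator_iff (measurableSet_tstar D i ⊤)).2
      ((integrable_condCohort_iff htop).1 hsq)).congr (Eventually.of_forall fun ω => ?_)
    by_cases hω : D.tstar i ω = ⊤
    · have : ω ∈ D.tstar i ⁻¹' {⊤} := hω
      simp only [Set.indicator_of_mem this, Function.comp_apply, contrastObservation,
        controlResidual, hω, if_true, Yobs, untreatedContrast, Y0]
    · simp [contrastObservation, controlResidual, hω]
  · rintro φ hφ ⟨B, hB⟩
    have h := integral_mul_controlResidual_pow (i := i) hO a hmm hφ one_ne_zero
    simp only [pow_one] at h
    have hψ : Measurable fun x => φ (⊤, x) := hφ.comp (by fun_prop)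
    rw [h, integral_mul_comp_eq_integral_mul_condExp (ψ := fun x => φ (⊤, x)) (D.measurable_X i)
      hψ (fun x => hB _) hRint]
    have h0 : (D.condCohort P i ⊤)[fun ω => D.untreatedContrast a i ω - m (D.X i ω) | D.sigmaX i]
        =ᵐ[D.condCohort P i ⊤] 0 := by
      have hsm : StronglyMeasurable[D.sigmaX i] fun ω => m (D.X i ω) :=
        (hmm.comp (comap_measurable _)).stronglyMeasurable
      have hmX' := integrable_condCohort_of_integrable htop hmX
      refine (condExp_sub (integrable_condCohort_of_integrable htop
        (integrable_untreatedContrast hR.mean a)) hmX' (D.sigmaX i)).trans ?_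
      rw [condExp_of_stronglyMeasurable (sigmaX_le D i) hsm hmX']
      filter_upwards [hcond] with ω hω
      rw [Pi.sub_apply, hω, sub_self]
      rfl
    rw [integral_eq_zero_of_ae, mul_zero]
    filter_upwards [h0] with ω hω
    rw [hω]
    simp
  · refine ⟨C, hC0, ?_⟩
    rintro φ hφ hφ0 ⟨B, hB⟩
    have hψ : Measurable fun x => φ (⊤, x) := hφ.comp (by fun_prop)
    rw [integral_mul_controlResidual_pow hO a hmm hφ two_ne_zero,
      integral_map (f := fun o => φ o.2) hV.aemeasurable
        (hφ.comp measurable_snd).aestronglyMeasurable]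
    have hφint : Integrable (fun ω => φ (D.tstar i ω, D.X i ω)) P :=
      Integrable.of_bound (hφ.comp ((D.measurable_tstar i).prodMk
        (D.measurable_X i))).aestronglyMeasurable B (Eventually.of_forall fun ω => hB _)
    calc P.real (D.tstar i ⁻¹' {⊤}) * ∫ ω, φ (⊤, D.X i ω) *
          (D.untreatedContrast a i ω - m (D.X i ω)) ^ 2 ∂(D.condCohort P i ⊤)
        ≤ P.real (D.tstar i ⁻¹' {⊤}) * (C * ∫ ω, φ (⊤, D.X i ω) ∂(D.condCohort P i ⊤)) :=
          mul_le_mul_of_nonneg_left (hC _ hψ (fun x => hφ0 _) ⟨B, fun x => hB _⟩)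
            measureReal_nonneg
      _ = C * ∫ ω in D.tstar i ⁻¹' {⊤}, φ (⊤, D.X i ω) ∂P := by
          rw [setIntegral_tstar htop]
          ring
      _ = C * ∫ ω in D.tstar i ⁻¹' {⊤}, φ (D.tstar i ω, D.X i ω) ∂P := by
          congr 1
          refine setIntegral_congr_fun (measurableSet_tstar D i ⊤) fun ω hω => ?_
          have : D.tstar i ω = ⊤ := hω
          simp only [this]
      -- As φ ≥ 0, the integral over the never-treated is at most the integral over all units.
      _ ≤ C * ∫ ω, φ (D.tstar i ω, D.X i ω) ∂P :=
          mul_le_mul_of_nonneg_left (setIntegral_le_integral hφint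
            (Eventually.of_forall fun ω => hφ0 _)) hC0

/-! ### The estimator -/

omit [IsProbabilityMeasure P] in
theorem pairwiseWeight_eq {n M : ℕ} (s : Fin T)
    (z : Fin n → Cohort T × EuclideanSpace ℝ (Fin q)) (j : Fin n) :
    pairwiseWeight M (fun i => (z i).1) (fun i => (z i).2) s j =
      (if (z j).1 = (s : Cohort T) then 1 else 0) + controlCount M (s : Cohort T) z j / M := by
  rw [pairwiseWeight, controlCount]
  split_ifs <;> simp

omit [IsProbabilityMeasure P] in
theorem measurable_pairwiseDiD (M : ℕ) (lam : Fin T → ℝ) (s : Fin T) (n : ℕ) :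
    Measurable (D.pairwiseDiD M lam s n) := by
  have hw : ∀ j : Fin n, Measurable fun ω =>
      pairwiseWeight M (fun i : Fin n => D.tstar i ω) (fun i : Fin n => D.X i ω) s j := by
    intro j
    simp only [fun ω => pairwiseWeight_eq (M := M) s
      (fun i : Fin n => (D.tstar i ω, D.X i ω)) j]
    refine (Measurable.ite (measurableSet_tstar D j s) measurable_const measurable_const).add
      (((measurable_controlCount j).comp (measurable_pi_lambda _ fun i : Fin n =>
        (D.measurable_tstar i).prodMk (D.measurable_X i))).div_const _)
  have ht : ∀ (j : Fin n) (t : Fin T),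
      Measurable fun ω => treated (fun i : Fin n => D.tstar i ω) j t := by
    intro j t
    exact (Measurable.of_discrete (f := fun c : Cohort T =>
      if c ≤ (t : Cohort T) then (1 : ℝ) else 0)).comp (D.measurable_tstar j)
  have hY : ∀ (j : Fin n) (t : Fin T), Measurable fun ω => D.Yobs j t ω := fun j t =>
    measurable_Yobs D j t
  unfold pairwiseDiD twfe demeanedTreated
  fun_prop

open scoped Classical in
omit [IsProbabilityMeasure P] in
-- Exactly M matches per treated unit give the controls the total weight required by `twfe_eq`.
theorem pairwiseDiD_eq_matchedDifference {M : ℕ} (hM : M ≠ 0) {lam : Fin T → ℝ} {s : Fin T}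
    (h1 : ∑ u with s ≤ u, lam u ≠ 0) (h0 : ∑ u with ¬ s ≤ u, lam u ≠ 0) (h : ∑ u, lam u ≠ 0)
    {n : ℕ} {ω : Ω}
    (hcard : ∀ l : Fin n, D.tstar l ω = s → (neighborFinset M (fun i : Fin n => D.tstar i ω)
      (fun i => D.X i ω) l ⊤).card = M)
    (hpos : (Finset.univ.filter fun i : Fin n => D.tstar i ω = (s : Cohort T)).card ≠ 0) :
    D.pairwiseDiD M lam s n ω = matchedDifference M (s : Cohort T)
      (fun i : Fin n => D.contrastObservation (periodWeight lam s) i ω) := by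
  have htop : ∀ i : Fin n, D.tstar i ω = ⊤ →
      pairwiseWeight M (fun i : Fin n => D.tstar i ω) (fun i => D.X i ω) s i =
        (matchCount M (fun i : Fin n => D.tstar i ω) (fun i => D.X i ω) i s : ℝ) / M := by
    intro i hi
    simp [pairwiseWeight, hi]
  rw [pairwiseDiD, twfe_eq _ h1 h0 h (fun i hi => by simp [pairwiseWeight, hi])
    (fun i hi hi' => by simp [pairwiseWeight, hi, hi']) ?_ hpos, matchedDifference]
  · congr 2
    refine Finset.sum_congr rfl fun i hi => ?_
    rw [htop i (Finset.mem_filter.1 hi).2]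
    rfl
  · rw [Finset.sum_congr rfl fun i hi => htop i (Finset.mem_filter.1 hi).2]
    exact sum_matchCount_div hM hcard

end Panel

/-! ### Consistency of the pairwise matched difference in differences -/

theorem theorem2 {T q : ℕ} (hq : 1 ≤ q) {Ω : Type*} [MeasurableSpace Ω]
    (P : Measure Ω) [IsProbabilityMeasure P] (D : Panel T q Ω)
    (hfirst : D.NoneTreatedFirst P)
    (hNA : D.NoAnticipation P)
    (hCPT : D.ConditionalParallelTrends P)
    (hOverlap : D.Overlap P)
    (hSampling : D.RandomSampling P)
    (hReg : D.Regularity P)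
    (M : ℕ) (hM : 1 ≤ M)
    (lam : Fin T → ℝ) (hlam : ∀ t, lam t = 0 ∨ lam t = 1)
    (s : Fin T) (hs : ∀ i, (s : Cohort T) ∈ D.cohorts P i)
    (hpre : ∃ t, t < s ∧ lam t = 1) (hpost : ∃ t, s ≤ t ∧ lam t = 1) :
    ∀ i : ℕ, TendstoInMeasure P (fun n : ℕ => D.pairwiseDiD M lam s n) atTop
      (fun _ => (∑ t with s ≤ t, lam t * D.att P i s t) / (∑ t with s ≤ t, lam t)) := by
  classical
  intro i
  have hnn : ∀ t, 0 ≤ lam t := fun t => by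
    rcases hlam t with h | h <;> simp [h]
  have hL1 : 0 < ∑ u with s ≤ u, lam u := by
    obtain ⟨t, hst, ht⟩ := hpost
    exact Finset.sum_pos' (fun u _ => hnn u) ⟨t, by simpa using hst, by simp [ht]⟩
  have hL0 : 0 < ∑ u with ¬ s ≤ u, lam u := by
    obtain ⟨t, hst, ht⟩ := hpre
    exact Finset.sum_pos' (fun u _ => hnn u) ⟨t, by simpa using hst, by simp [ht]⟩
  have hL : 0 < ∑ u, lam u := by
    rw [← Finset.sum_filter_add_sum_filter_not Finset.univ (fun u => s ≤ u) lam]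
    exact add_pos hL1 hL0
  have hM0 : M ≠ 0 := Nat.one_le_iff_ne_zero.1 hM
  set a := periodWeight lam s with ha
  have ha0 : ∑ t, a t = 0 := sum_periodWeight hL.ne'
  obtain ⟨m, K, hm, hcond⟩ := Panel.exists_lipschitz_condExp (i := i) hOverlap hReg.mean a
  have hμ := Panel.matchingModel hq hOverlap hReg a (hs i) hm hcond
  have hV := Panel.measurable_contrastObservation D a
  have hind := Panel.iIndepFun_contrastObservation hSampling a
  have hlaw := fun j => Panel.map_contrastObservation_eq (i := i) hSampling a j
  have hprob : IsProbabilityMeasure (P.map (D.contrastObservation a i)) :=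
    Measure.isProbabilityMeasure_map (hV i).aemeasurable
  have heq : ∀ᵐ ω ∂P, ∀ᶠ n : ℕ in atTop, D.pairwiseDiD M lam s n ω =
      matchedDifference M (s : Cohort T) (fun j : Fin n => D.contrastObservation a j ω) := by
    -- Only the number of matches matters here, so the radius 1 is arbitrary.
    filter_upwards [ae_eventually_matches hμ WithTop.coe_ne_top hV hind hlaw M one_pos,
      ae_eventually_le_card hV hind hlaw (measurableSet_cohort (s : Cohort T))
        hμ.treated_ne_zero 1] with ω h1 h2
    filter_upwards [h1, h2] with n h1 h2
    refine Panel.pairwiseDiD_eq_matchedDifference hM0 hL1.ne' hL0.ne' hL.ne'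
      (fun l hl => (h1 l hl).1) (Nat.one_le_iff_ne_zero.1 ?_)
    convert h2
    rfl
  have hlim := tendstoInMeasure_of_eventually_eq_matchedDifference hμ WithTop.coe_ne_top hV hind
    hlaw hM0 (Panel.measurable_pairwiseDiD M lam s) heq
  have htarget : (∫ o in {o | o.2.1 = (s : Cohort T)}, (o.1 - m o.2.2)
        ∂(P.map (D.contrastObservation a i))) /
      (P.map (D.contrastObservation a i)).real {o | o.2.1 = (s : Cohort T)} =
      (∑ t with s ≤ t, lam t * D.att P i s t) / (∑ t with s ≤ t, lam t) := by
    have hmm : Measurable m := hm.continuous.measurable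
    rw [setIntegral_map (measurableSet_cohort (s : Cohort T)) (by fun_prop) (hV i).aemeasurable,
      map_measureReal_apply (hV i) (measurableSet_cohort (s : Cohort T))]
    have h := Panel.integral_contrast_sub hReg.densities hOverlap hReg.mean hCPT ha0 hm hcond (hs i)
    rw [Panel.integral_condCohort, inv_mul_eq_div] at h
    refine Eq.trans h ?_
    -- Termwise comparison: after `s` the period weight is λ_t divided by the post-period total, and
    -- before `s` the effect vanishes.
    rw [Finset.sum_div, Finset.sum_filter]
    refine Finset.sum_congr rfl fun t _ => ?_
    split_ifs with hst
    · rw [ha, periodWeight_of_le hL1.ne' hL0.ne' hL.ne' hst]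
      ring
    · rw [Panel.att_eq_zero_of_lt hNA (not_le.1 hst), mul_zero]
  rwa [htarget] at hlim
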